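/- Let $X$ be a (real or complex) Banach space that is uniformly convex and uniformly smooth, and let $\delta(\epsilon)=\inf\{1-\|\tfrac{x+y}{2}\| : \|x\|=\|y\|=1,\ \|x-y\|=\epsilon\}$, $0\le\epsilon\le2$, be its modulus of convexity (with $\inf\emptyset:=0$, which matters only if $\dim_{\mathbb R} X\le 1$). A sequence $(u_k)\subset X$ is said to $\Delta$-converge to $u$, written $u_k\rightharpoondown u$, if $\|u_k-u\|\le\|u_k-y\|+o(1)$ as $k\to\infty$ for every $y\in X$. For operators, $g_k\rightharpoonup 0$ means that $g_kx\rightharpoonup0$ weakly for every $x\in X$. A group $D_0$ of (bijective) linear isometries of $X$ is called a dislocation group if (*) for every sequence $(g_k)\subset D_0$ with $g_k\not\rightharpoonup0$ there is a subsequence $(g_{k_j})$ such that $(g_{k_j})$ and $(g_{k_j}^{-1})$ both converge strongly (pointwise in norm); and (**) if $u_k\rightharpoondown0$, $w\in X$, $(g_k)\subset D_0$ and $g_k\rightharpoonup0$, then $u_k+g_kw\rightharpoondown0$. Let $D_0$ be a dislocation group and let $D\subset D_0$ contain $\mathrm{Id}$. A $\Delta$-profile decomposition, relative to $D$, of a bounded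 sequence $(x_k)\subset X$ consists of a subsequence $(u_k)$ of $(x_k)$, a number $N\in\{1,2,\dots\}\cup\{\infty\}$ and, for the indices $1\le n\le N$ ($n\in\mathbb N$), elements $w^{(n)}\in X$ and sequences $(g_k^{(n)})_k\subset D$ with $g_k^{(1)}=\mathrm{Id}$, together with a sequence $(r_k)\subset X$, such that - $(g_k^{(n)})^{-1}g_k^{(m)}\rightharpoonup0$ as $k\to\infty$ whenever $m\ne n$ (asymptotic decoupling of gauges); - $u_k=\sum_{n}g_k^{(n)}w^{(n)}+r_k$ for every $k$, where the series (a finite sum if $N<\infty$) converges in norm unconditionally and uniformly with respect to $k$, i.e. the net of its finite partial sums, indexed by the finite sets of indices, converges uniformly in $k$; - $h_k^{-1}r_k\rightharpoondown0$ for every sequence $(h_k)\subset D$ (that is, $r_k\to0$ in the $D$-$\Delta$ sense). Then every bounded sequence $(x_k)\subset X$ admits a $\Delta$-profile decomposition relative to $D$. Moreover, every $\Delta$-profile decomposition of $(x_k)$ satisfies $(g_k^{(n)})^{-1}u_k\rightharpoondown w^{(n)}$ for every $n$, and, if $\|x_k\|\le1$ for all $k$, it also satisfies $\|w^{(n)}\|\le2$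 for every $n$ and $$\limsup_{k\to\infty}\|r_k\|+\sum_{n}\delta(\|w^{(n)}\|)\le1.$$ -/

import Mathlib

open Filter Topology

/-- Uniform smoothness of a normed space. -/
def IsUniformlySmooth (X : Type*) [NormedAddCommGroup X] : Prop :=
  ∀ ε : ℝ, 0 < ε → ∃ δ : ℝ, 0 < δ ∧ ∀ x y : X, ‖x‖ = 1 → ‖y‖ ≤ δ →
    ‖x + y‖ + ‖x - y‖ ≤ 2 + ε * ‖y‖

/-- The modulus of convexity: the infimum of `1 - ‖(x + y) / 2‖` over unit vectors `x`, `y` with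
`‖x - y‖ = ε`. It is meant for `0 ≤ ε ≤ 2`; if there is no such pair (for `0 ≤ ε ≤ 2` this
happens only in real dimension at most one) the value is `0`. -/
noncomputable def modulusOfConvexity (X : Type*) [NormedAddCommGroup X] (ε : ℝ) : ℝ :=
  sInf {t : ℝ | ∃ x y : X, ‖x‖ = 1 ∧ ‖y‖ = 1 ∧ ‖x - y‖ = ε ∧ t = 1 - ‖x + y‖ / 2}

/-- `x` is a `Δ`-limit of `u`: for every `y`, `‖u k - x‖ ≤ ‖u k - y‖ + o(1)`. -/
def DeltaTendsto {X : Type*} [NormedAddCommGroup X] (u : ℕ → X) (x : X) : Prop :=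
  ∀ y : X, ∀ ε : ℝ, 0 < ε → ∀ᶠ k in atTop, ‖u k - x‖ ≤ ‖u k - y‖ + ε

section Gauges

variable {𝕜 X : Type*} [RCLike 𝕜] [NormedAddCommGroup X] [NormedSpace 𝕜 X]

/-- `g k ⇀ 0` in the weak operator sense: `g k x ⇀ 0` weakly in `X` for every `x`. -/
def WeakOpTendstoZero (g : ℕ → X ≃ₗᵢ[𝕜] X) : Prop :=
  ∀ x : X, Tendsto (fun k => toWeakSpace 𝕜 X (g k x)) atTop (𝓝 (toWeakSpace 𝕜 X 0))

/-- Operator-strong (pointwise, in norm) convergence of a sequence of linear isometries. -/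
def StrongOpConverges (g : ℕ → X ≃ₗᵢ[𝕜] X) : Prop :=
  ∀ x : X, ∃ y : X, Tendsto (fun k => g k x) atTop (𝓝 y)

/-- Dislocation groups of bijective linear isometries. -/
structure IsDislocationGroup (D₀ : Subgroup (X ≃ₗᵢ[𝕜] X)) : Prop where
  /-- A sequence in `D₀` that does not converge weakly to zero has a subsequence which converges
  strongly together with its inverses. -/
  exists_strongly_convergent : ∀ g : ℕ → X ≃ₗᵢ[𝕜] X, (∀ k, g k ∈ D₀) → ¬ WeakOpTendstoZero g →
    ∃ φ : ℕ → ℕ, StrictMono φ ∧ StrongOpConverges (fun j => (g (φ j))⁻¹) ∧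
      StrongOpConverges (fun j => g (φ j))
  /-- Adding an elementary concentration preserves `Δ`-convergence to zero. -/
  deltaTendsto_add : ∀ (u : ℕ → X) (w : X) (g : ℕ → X ≃ₗᵢ[𝕜] X), DeltaTendsto u 0 →
    (∀ k, g k ∈ D₀) → WeakOpTendstoZero g → DeltaTendsto (fun k => u k + g k w) 0

/-- `u` has the `D`-`Δ`-limit `x`. -/
def GaugedDeltaTendsto (D : Set (X ≃ₗᵢ[𝕜] X)) (u : ℕ → X) (x : X) : Prop :=
  ∀ g : ℕ → X ≃ₗᵢ[𝕜] X, (∀ k, g k ∈ D) → DeltaTendsto (fun k => (g k)⁻¹ (u k - x)) 0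

/-- A `Δ`-profile decomposition, relative to `D`, of the subsequence `x ∘ φ` of `x`.
There are `N` profiles, `1 ≤ N ≤ ∞`, with indices `n < N` (counted from `0`; the gauge with index
`0` is the identity). The data with indices `n ≥ N` are padding with `w n = 0`. -/
structure IsDeltaProfileDecomposition (D : Set (X ≃ₗᵢ[𝕜] X)) (x : ℕ → X) (φ : ℕ → ℕ) (N : ℕ∞)
    (g : ℕ → ℕ → X ≃ₗᵢ[𝕜] X) (w : ℕ → X) (r : ℕ → X) : Prop where
  strictMono : StrictMono φ
  one_le : 1 ≤ N
  profile_eq_zero : ∀ n : ℕ, N ≤ (n : ℕ∞) → w n = 0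
  gauge_mem : ∀ n k, g n k ∈ D
  gauge_zero : ∀ k, g 0 k = 1
  /-- Asymptotic decoupling of gauges. -/
  decoupled : ∀ m n : ℕ, (m : ℕ∞) < N → (n : ℕ∞) < N → m ≠ n →
    WeakOpTendstoZero (fun k => (g n k)⁻¹ * g m k)
  /-- For each `k` the series of elementary concentrations converges unconditionally. -/
  summable : ∀ k, Summable (fun n => g n k (w n))
  /-- The unconditional convergence (along the net of finite partial sums) is uniform in `k`. -/
  uniform : TendstoUniformly (fun (s : Finset ℕ) (k : ℕ) => ∑ n ∈ s, g n k (w n))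
    (fun k => ∑' n, g n k (w n)) atTop
  eq_add : ∀ k, x (φ k) = (∑' n, g n k (w n)) + r k
  remainder : GaugedDeltaTendsto D r 0

end Gauges

/-! ### Uniform convexity on balls and the modulus of convexity. -/

section Geometry

variable {X : Type*} [NormedAddCommGroup X]

/-! A sequence `v` has zero profile at the gauge `h` exactly when adding terms `h k y` cannot
asymptotically shorten it (`deltaLim_inv_iff`). Condition (**) preserves this under adding decoupled
concentrations, and (*) forces decoupling of a gauge with nonzero profile from one with zero profile
(`weakOpLim_of_deltaLim`).

Profiles are extracted greedily, each after the first within a factor 2 of the largest available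
one; `exists_le_deltaLim` supplies Δ-limits through asymptotic centers. The limiting norms of the
remainders decrease, hence eventually vary little. Restoring a finite set of late concentrations to
a later remainder moves between vectors of almost equal norm whose midpoint is not shorter, so
uniform convexity makes the restored sum small (`exists_forall_eventually_norm_sum_le`). Changing
finitely many gauges for each index makes this smallness uniform in `k`. Late profiles tend to zero,
so almost maximality leaves no profile in the remainder.

For the energy bound, the midpoint of 0 and a Δ-limit is tested as a competitor: subtracting a
profile costs at least its modulus of convexity in norm (`norm_sub_add_modulusOfConvexity_le`), and
the costs add up. -/

theorem one_sub_norm_add_nonneg {a b : X} (ha : ‖a‖ ≤ 1) (hb : ‖b‖ ≤ 1) :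
    0 ≤ 1 - ‖a + b‖ / 2 := by
  linarith [norm_add_le a b]

theorem modulusOfConvexity_nonneg (t : ℝ) : 0 ≤ modulusOfConvexity X t := by
  refine Real.sInf_nonneg ?_
  rintro _ ⟨x, y, hx, hy, -, rfl⟩
  exact one_sub_norm_add_nonneg hx.le hy.le

theorem modulusOfConvexity_le {a b : X} (ha : ‖a‖ = 1) (hb : ‖b‖ = 1) :
    modulusOfConvexity X ‖a - b‖ ≤ 1 - ‖a + b‖ / 2 := by
  refine csInf_le ⟨0, ?_⟩ ⟨a, b, ha, hb, rfl, rfl⟩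
  rintro _ ⟨x, y, hx, hy, -, rfl⟩
  exact one_sub_norm_add_nonneg hx.le hy.le

variable [NormedSpace ℝ X]

theorem exists_unit_smul_eq [Nontrivial X] (m : X) : ∃ e : X, ‖e‖ = 1 ∧ m = ‖m‖ • e := by
  by_cases hm : m = 0
  · obtain ⟨e, he⟩ := exists_norm_eq X (zero_le_one : (0 : ℝ) ≤ 1)
    exact ⟨e, he, by simp [hm]⟩
  · have h : ‖m‖ ≠ 0 := norm_ne_zero_iff.2 hm
    refine ⟨‖m‖⁻¹ • m, ?_, ?_⟩
    · rw [norm_smul, norm_inv, norm_norm, inv_mul_cancel₀ h]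
    · rw [smul_smul, mul_inv_cancel₀ h, one_smul]

/-- Two vectors in a ball can be translated into a larger concentric ball so that the norm of
their sum grows by the full difference of the diameters. -/
theorem exists_translate_norm_add_eq [Nontrivial X] {a b : X} {ρ C : ℝ} (ha : ‖a‖ ≤ ρ)
    (hb : ‖b‖ ≤ ρ) (hC : ρ ≤ C) :
    ∃ a' b' : X, ‖a'‖ ≤ C ∧ ‖b'‖ ≤ C ∧ a' - b' = a - b ∧
      ‖a' + b'‖ = ‖a + b‖ + 2 * (C - ρ) := by
  obtain ⟨e, he, hm⟩ := exists_unit_smul_eq (a + b)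
  have hn : ‖(C - ρ) • e‖ = C - ρ := by
    rw [norm_smul, he, mul_one, Real.norm_of_nonneg (by linarith)]
  refine ⟨a + (C - ρ) • e, b + (C - ρ) • e, ?_, ?_, by abel, ?_⟩
  · linarith [norm_add_le a ((C - ρ) • e)]
  · linarith [norm_add_le b ((C - ρ) • e)]
  · have h : a + (C - ρ) • e + (b + (C - ρ) • e) = (‖a + b‖ + 2 * (C - ρ)) • e := by
      rw [add_smul, ← hm, two_mul, add_smul]; abel
    rw [h, norm_smul, he, mul_one, Real.norm_of_nonneg]
    linarith [norm_nonneg (a + b)]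

/-- Uniform convexity, uniformly over all balls of radius at most `C`. -/
theorem exists_pos_norm_sub_le_of_norm_le [UniformConvexSpace X] (C : ℝ) {ε : ℝ} (hε : 0 < ε) :
    ∃ η : ℝ, 0 < η ∧ ∀ (a b : X) (ρ : ℝ), ρ ≤ C → ‖a‖ ≤ ρ → ‖b‖ ≤ ρ →
      ρ - η ≤ ‖a + b‖ / 2 → ‖a - b‖ ≤ ε := by
  rcases subsingleton_or_nontrivial X with hs | hs
  · exact ⟨1, one_pos, fun a b _ _ _ _ _ => by
      rw [Subsingleton.elim (a - b) 0, norm_zero]; exact hε.le⟩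
  obtain ⟨δ, hδ, h⟩ := exists_forall_closed_ball_dist_add_le_two_mul_sub X hε C
  refine ⟨δ / 4, by positivity, fun a b ρ hρ ha hb hab => ?_⟩
  by_contra! hlt
  obtain ⟨a', b', ha', hb', hsub, hadd⟩ := exists_translate_norm_add_eq ha hb hρ
  have := h ha' hb' (by rw [hsub]; exact hlt.le)
  linarith

/-- If `b` is asymptotically not longer than the midpoint of `a` and `b`, and `a` is not much longer
than `b`, then `a` is close to `b`. -/
theorem exists_pos_norm_sub_le [UniformConvexSpace X] (C : ℝ) {ε : ℝ} (hε : 0 < ε) :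
    ∃ η : ℝ, 0 < η ∧ ∀ a b : X, ‖b‖ ≤ C → ‖a‖ ≤ ‖b‖ + η → ‖b‖ ≤ ‖a + b‖ / 2 + η →
      ‖a - b‖ ≤ ε := by
  obtain ⟨η, hη, h⟩ := exists_pos_norm_sub_le_of_norm_le (X := X) (C + 1) hε
  refine ⟨min 1 (η / 2), by positivity, fun a b hb hab hm => ?_⟩
  have h1 := min_le_left 1 (η / 2)
  have h2 := min_le_right 1 (η / 2)
  have h3 : 0 < min 1 (η / 2) := by positivity
  exact h a b (‖b‖ + min 1 (η / 2)) (by linarith) hab (by linarith) (by linarith)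

/-- Rotate `q` about `p` toward the direction of `p + q`, at fixed distance, until it meets the unit
sphere. A functional norming `p + q` does not fall below its initial value on the way. -/
theorem exists_unit_norm_sub_eq_norm_add_ge {p q : X} (hp : ‖p‖ ≤ 1) (hq : ‖q‖ ≤ 1) (hpq : p ≠ q)
    (h2 : 2 - ‖p - q‖ < ‖p + q‖) :
    ∃ q' : X, ‖q'‖ = 1 ∧ ‖p - q'‖ = ‖p - q‖ ∧ ‖p + q‖ ≤ ‖p + q'‖ := by
  set t := ‖p - q‖ with ht
  have ht0 : 0 < t := norm_pos_iff.2 (sub_ne_zero.2 hpq)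
  have ht2 : t ≤ 2 := (norm_sub_le p q).trans (by linarith)
  have hs0 : 0 < ‖p + q‖ := by linarith
  obtain ⟨f, hf1, hfs⟩ := exists_dual_vector ℝ (p + q) hs0.ne'
  have hfle : ∀ z, f z ≤ ‖z‖ := fun z => by
    have := f.le_opNorm z
    rw [hf1, one_mul] at this
    exact (le_abs_self _).trans this
  set e : X := ‖p + q‖⁻¹ • (p + q) with he
  have he1 : ‖e‖ = 1 := by
    rw [he, norm_smul, norm_inv, norm_norm, inv_mul_cancel₀ hs0.ne']
  have hse : p + q = ‖p + q‖ • e := by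
    rw [he, smul_smul, mul_inv_cancel₀ hs0.ne', one_smul]
  have hfe : f e = 1 := by
    rw [he, map_smul, hfs]
    simp [hs0.ne']
  set d : X := t⁻¹ • (q - p) with hd
  have hd1 : ‖d‖ = 1 := by
    rw [hd, norm_smul, norm_inv, norm_sub_rev, Real.norm_of_nonneg ht0.le, ← ht,
      inv_mul_cancel₀ ht0.ne']
  have hqd : q = p + t • d := by
    rw [hd, smul_smul, mul_inv_cancel₀ ht0.ne', one_smul]; abel
  have hfd1 : f d ≤ 1 := hd1 ▸ hfle d
  have hfd2 : -1 ≤ f d := by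
    have := hfle (-d)
    rw [norm_neg, hd1, map_neg] at this
    linarith
  have hfpq : f p + f q = ‖p + q‖ := by rw [← map_add, hfs]; rfl
  have hfq : f q = f p + t * f d := by
    conv_lhs => rw [hqd]
    simp
  clear_value d e
  let v : ℝ → X := fun s => (1 - s) • d + s • e
  have hvle : ∀ s, 0 ≤ s → s ≤ 1 → ‖v s‖ ≤ 1 := fun s h0 h1 => by
    refine (norm_add_le _ _).trans ?_
    rw [norm_smul, norm_smul, hd1, he1, Real.norm_of_nonneg h0,
      Real.norm_of_nonneg (by linarith)]
    linarith
  have hvge : ∀ s, 0 ≤ s → s ≤ 1 → 1 - 2 * s ≤ ‖v s‖ := fun s h0 h1 => by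
    have := norm_sub_le_norm_add ((1 - s) • d) (s • e)
    rw [norm_smul, norm_smul, hd1, he1, Real.norm_of_nonneg h0,
      Real.norm_of_nonneg (by linarith)] at this
    change 1 - 2 * s ≤ ‖(1 - s) • d + s • e‖
    linarith
  -- The segment from `d` to `e` meets 0 only if `d = -e`; then `2 • p` has norm `‖p + q‖ + t > 2`,
  -- which is impossible.
  have hv0 : ∀ s, 0 ≤ s → s ≤ 1 → v s ≠ 0 := fun s h0 h1 hv => by
    have hn : (1 - s) • d = -(s • e) := eq_neg_of_add_eq_zero_left hv
    have hs : 1 - s = s := by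
      have := congrArg norm hn
      rwa [norm_neg, norm_smul, norm_smul, hd1, he1, Real.norm_of_nonneg h0,
        Real.norm_of_nonneg (by linarith), mul_one, mul_one] at this
    have hs' : s ≠ 0 := by rintro rfl; norm_num at hs
    have hde : d = -e := by
      rw [hs, ← smul_neg] at hn
      exact smul_right_injective X hs' hn
    have h2p : (2 : ℝ) • p = (‖p + q‖ + t) • e := by
      rw [add_smul, ← hse]
      conv_rhs => rw [hqd, hde]
      rw [two_smul, smul_neg]; abel
    have := congrArg norm h2p
    rw [norm_smul, norm_smul, he1, Real.norm_of_nonneg zero_le_two,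
      Real.norm_of_nonneg (by linarith)] at this
    linarith
  -- After normalizing `v s`, its `f`-value is at least `f d`. The sign of `f d` decides whether the
  -- upper or the lower bound on `‖v s‖` is needed.
  have hfv : ∀ s, 0 ≤ s → s ≤ 1 → f d * ‖v s‖ ≤ f (v s) := fun s h0 h1 => by
    have hv : f (v s) = (1 - s) * f d + s := by simp [v, hfe]
    rw [hv]
    rcases le_total 0 (f d) with h | h
    · nlinarith [mul_le_mul_of_nonneg_left (hvle s h0 h1) h]
    · nlinarith [mul_le_mul_of_nonpos_left (hvge s h0 h1) h]
  let c : ℝ → X := fun s => p + (t / ‖v s‖) • v s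
  have hcont : ContinuousOn (fun s => ‖c s‖) (Set.Icc 0 1) := by
    have hvc : Continuous v := by fun_prop
    refine (continuousOn_const.add (ContinuousOn.smul (continuousOn_const.div
      hvc.norm.continuousOn fun s hs => norm_ne_zero_iff.2 (hv0 s hs.1 hs.2))
      hvc.continuousOn)).norm
  have hc0 : ‖c 0‖ ≤ 1 := by
    have : c 0 = q := by
      simp only [c, v, sub_zero, one_smul, zero_smul, add_zero, hd1, div_one]
      exact hqd.symm
    rwa [this]
  have hc1 : 1 ≤ ‖c 1‖ := by
    have : c 1 = p + t • e := by simp [c, v, he1]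
    rw [this]
    have h3 := hfle (p + t • e)
    simp only [map_add, map_smul, hfe, smul_eq_mul, mul_one] at h3
    linarith [hfle q]
  obtain ⟨s, hs, hs1⟩ := intermediate_value_Icc zero_le_one hcont ⟨hc0, hc1⟩
  have hvpos : 0 < ‖v s‖ := norm_pos_iff.2 (hv0 s hs.1 hs.2)
  refine ⟨c s, hs1, ?_, ?_⟩
  · have : p - c s = -((t / ‖v s‖) • v s) := by simp [c]
    rw [this, norm_neg, norm_smul, Real.norm_of_nonneg (by positivity), div_mul_cancel₀ _ hvpos.ne']
  · refine le_trans ?_ (hfle _)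
    have h4 : f (c s) = f p + t / ‖v s‖ * f (v s) := by simp [c]
    have h5 : t * f d ≤ t / ‖v s‖ * f (v s) := by
      rw [div_mul_eq_mul_div, le_div_iff₀ hvpos, mul_assoc]
      exact mul_le_mul_of_nonneg_left (hfv s hs.1 hs.2) ht0.le
    rw [map_add, h4]
    linarith

/-- The modulus of convexity, defined on the unit sphere, controls midpoints in the unit ball. -/
theorem modulusOfConvexity_le_of_norm_le_one {p q : X} (hp : ‖p‖ ≤ 1) (hq : ‖q‖ ≤ 1) :
    modulusOfConvexity X ‖p - q‖ ≤ 1 - ‖p + q‖ / 2 := by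
  have h0 := one_sub_norm_add_nonneg hp hq
  by_cases hne : ∃ x y : X, ‖x‖ = 1 ∧ ‖y‖ = 1 ∧ ‖x - y‖ = ‖p - q‖
  -- For a short sum any admissible unit pair suffices, by the triangle inequality. Otherwise the
  -- two points are pushed to the sphere one after the other.
  · by_cases h2 : ‖p + q‖ ≤ 2 - ‖p - q‖
    · obtain ⟨x, y, hx, hy, hxy⟩ := hne
      have h1 := modulusOfConvexity_le hx hy
      rw [hxy] at h1
      have h3 : ‖x - y‖ + ‖x + y‖ ≥ 2 := by
        have := norm_add_le (x - y) (x + y)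
        rw [sub_add_add_cancel, ← two_smul ℝ x, norm_smul, hx] at this
        norm_num at this
        linarith
      linarith
    · push Not at h2
      by_cases hpq : p = q
      · obtain ⟨x, -, hx, -⟩ := hne
        have h1 := modulusOfConvexity_le hx hx
        rw [sub_self, ← two_smul ℝ x, norm_smul, hx] at h1
        norm_num at h1
        rw [hpq, sub_self, norm_zero]
        linarith [one_sub_norm_add_nonneg hq hq]
      obtain ⟨q', hq', hs, ha⟩ := exists_unit_norm_sub_eq_norm_add_ge hp hq hpq h2
      have hpq' : q' ≠ p := by
        rintro rfl
        rw [sub_self, norm_zero] at hs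
        exact hpq (sub_eq_zero.1 (norm_eq_zero.1 hs.symm))
      obtain ⟨p', hp', hs', ha'⟩ := exists_unit_norm_sub_eq_norm_add_ge hq'.le hp hpq'
        (by rw [norm_sub_rev, hs, add_comm q' p]; linarith)
      have h1 := modulusOfConvexity_le hq' hp'
      rw [hs', norm_sub_rev, hs] at h1
      rw [add_comm q' p] at ha'
      linarith
  · have : modulusOfConvexity X ‖p - q‖ = 0 := by
      have he : {t : ℝ | ∃ x y : X, ‖x‖ = 1 ∧ ‖y‖ = 1 ∧ ‖x - y‖ = ‖p - q‖ ∧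
          t = 1 - ‖x + y‖ / 2} = ∅ := by
        ext t
        simp only [Set.mem_ofPred_eq, Set.mem_empty_iff_false, iff_false]
        rintro ⟨x, y, hx, hy, hxy, -⟩
        exact hne ⟨x, y, hx, hy, hxy⟩
      rw [modulusOfConvexity, he, Real.sInf_empty]
    rwa [this]

/-- Translation into the unit ball, rather than scaling, keeps the difference `a - b`, so the
modulus is evaluated at `‖a - b‖` without division by `ρ`. -/
theorem norm_add_le_sub_modulusOfConvexity {a b : X} {ρ : ℝ} (ha : ‖a‖ ≤ ρ) (hb : ‖b‖ ≤ ρ)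
    (hρ : ρ ≤ 1) : ‖a + b‖ / 2 ≤ ρ - modulusOfConvexity X ‖a - b‖ := by
  rcases subsingleton_or_nontrivial X with hs | hs
  · have h0 : modulusOfConvexity X ‖a - b‖ = 0 := by
      rw [modulusOfConvexity]
      convert Real.sInf_empty
      rw [Set.eq_empty_iff_forall_notMem]
      rintro t ⟨x, -, hx, -⟩
      rw [Subsingleton.elim x 0, norm_zero] at hx
      exact zero_ne_one hx
    rw [h0]
    linarith [norm_add_le a b]
  · obtain ⟨a', b', ha', hb', hsub, hadd⟩ := exists_translate_norm_add_eq ha hb hρ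
    have := modulusOfConvexity_le_of_norm_le_one ha' hb'
    rw [hsub, hadd] at this
    linarith

theorem modulusOfConvexity_norm_zero : modulusOfConvexity X ‖(0 : X)‖ = 0 := by
  have h0 := norm_add_le_sub_modulusOfConvexity (a := (0 : X)) (b := 0) (ρ := 0)
    norm_zero.le norm_zero.le zero_le_one
  simp only [sub_zero, norm_zero, add_zero, zero_div, zero_sub] at h0 ⊢
  exact le_antisymm (by linarith) (modulusOfConvexity_nonneg 0)

end Geometry

/-! ### Delta limits along filters -/

/-- `x` is a `Δ`-limit of `u` along the filter `F`. -/
def DeltaLim {ι X : Type*} [NormedAddCommGroup X] (F : Filter ι) (u : ι → X) (x : X) : Prop :=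
  ∀ y : X, ∀ ε : ℝ, 0 < ε → ∀ᶠ k in F, ‖u k - x‖ ≤ ‖u k - y‖ + ε

theorem exists_seq_of_forall_exists {α : Type*} {R : ℕ → α → α → Prop}
    (h : ∀ n a, ∃ b, R n a b) (a : α) : ∃ f : ℕ → α, f 0 = a ∧ ∀ n, R n (f n) (f (n + 1)) := by
  choose next hnext using h
  exact ⟨fun n => Nat.rec a next n, rfl, fun n => hnext n _⟩

/-! ### Countably generated filters in the role of subsequences. -/

section Filters

variable {ι : Type*} {F : Filter ι}

theorem Filter.Frequently.exists_le_eventually [F.IsCountablyGenerated] {p : ι → Prop}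
    (h : ∃ᶠ k in F, p k) :
    ∃ G ≤ F, G.NeBot ∧ G.IsCountablyGenerated ∧ ∀ᶠ k in G, p k :=
  ⟨F ⊓ 𝓟 {k | p k}, inf_le_left, frequently_iff_neBot.1 h, inferInstance,
    eventually_inf_principal.2 (Eventually.of_forall fun _ hx => hx)⟩

theorem Filter.exists_le_tendsto_of_bounded [F.NeBot] [F.IsCountablyGenerated] {f : ι → ℝ} {C : ℝ}
    (hf : ∀ k, |f k| ≤ C) :
    ∃ G ≤ F, G.NeBot ∧ G.IsCountablyGenerated ∧ ∃ c, Tendsto f G (𝓝 c) := by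
  have hle : map f F ≤ 𝓟 (Set.Icc (-C) C) :=
    tendsto_principal.2 (Eventually.of_forall fun k => abs_le.1 (hf k))
  obtain ⟨c, -, hc⟩ := isCompact_Icc (f := map f F) hle
  refine ⟨F ⊓ comap f (𝓝 c), inf_le_left, ?_, inferInstance, c, ?_⟩
  · rw [neBot_inf_comap_iff_map, inf_comm]
    exact hc
  · exact tendsto_comap.mono_left inf_le_right

/-- The infimum of the chain replaces the diagonal subsequence. -/
theorem Filter.exists_le_forall_le {f : ℕ → Filter ι} (hf : ∀ n, f (n + 1) ≤ f n)
    (hn : ∀ n, (f n).NeBot) (hc : ∀ n, (f n).IsCountablyGenerated) :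
    ∃ G : Filter ι, G.NeBot ∧ G.IsCountablyGenerated ∧ ∀ n, G ≤ f n := by
  have ha : Antitone f := antitone_nat_of_succ_le hf
  exact ⟨⨅ n, f n, iInf_neBot_of_directed' ha.directed_ge hn, inferInstance, iInf_le f⟩

/-- A monotone nonnegative function of filters becomes stable after passing to a subsequence. -/
theorem Filter.exists_le_minimal [F.NeBot] [F.IsCountablyGenerated] {R : Filter ι → ℝ}
    (h0 : ∀ G : Filter ι, G.NeBot → 0 ≤ R G) (hR : ∀ G H : Filter ι, G.NeBot → H ≤ F →
      G ≤ H → R G ≤ R H) :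
    ∃ H ≤ F, H.NeBot ∧ H.IsCountablyGenerated ∧
      ∀ G ≤ H, G.NeBot → G.IsCountablyGenerated → R H ≤ R G := by
  let S := {G : Filter ι // G ≤ F ∧ G.NeBot ∧ G.IsCountablyGenerated}
  have step : ∀ (n : ℕ) (H : S), ∃ H' : S, H'.1 ≤ H.1 ∧
      ∀ G ≤ H.1, G.NeBot → G.IsCountablyGenerated → R H'.1 ≤ R G + 1 / ((n : ℝ) + 1) := by
    intro n H
    let A : Set ℝ := {t | ∃ G ≤ H.1, G.NeBot ∧ G.IsCountablyGenerated ∧ R G = t}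
    have hA : A.Nonempty := ⟨_, H.1, le_rfl, H.2.2.1, H.2.2.2, rfl⟩
    have hb : BddBelow A := ⟨0, by rintro _ ⟨G, -, hG, -, rfl⟩; exact h0 G hG⟩
    have hpos : (0 : ℝ) < 1 / ((n : ℝ) + 1) := by positivity
    obtain ⟨_, ⟨H', hH', hn, hc, rfl⟩, hlt⟩ := exists_lt_of_csInf_lt hA (lt_add_of_pos_right _ hpos)
    refine ⟨⟨H', hH'.trans H.2.1, hn, hc⟩, hH', fun G hG hGn hGc => hlt.le.trans ?_⟩
    have : sInf A ≤ R G := csInf_le hb ⟨G, hG, hGn, hGc, rfl⟩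
    linarith
  obtain ⟨f, -, hf⟩ := exists_seq_of_forall_exists step ⟨F, le_rfl, ‹_›, ‹_›⟩
  obtain ⟨H, hHn, hHc, hH⟩ := Filter.exists_le_forall_le (f := fun n => (f n).1)
    (fun n => (hf n).1) (fun n => (f n).2.2.1) (fun n => (f n).2.2.2)
  refine ⟨H, (hH 0).trans (f 0).2.1, hHn, hHc, fun G hG hGn hGc => ?_⟩
  refine le_of_forall_pos_le_add fun ε hε => ?_
  obtain ⟨n, hn⟩ := exists_nat_one_div_lt hε
  have h1 := (hf n).2 G (hG.trans (hH n)) hGn hGc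
  have h2 := hR H (f (n + 1)).1 hHn (f (n + 1)).2.1 (hH (n + 1))
  linarith

end Filters

/-! ### Δ-limits and asymptotic centers in uniformly convex spaces. -/

section DeltaLimits

variable {ι X : Type*} [NormedAddCommGroup X] {F G : Filter ι} {u v : ι → X} {x y : X}

theorem DeltaLim.mono (h : DeltaLim F u x) (hG : G ≤ F) : DeltaLim G u x :=
  fun y ε hε => hG (h y ε hε)

theorem DeltaLim.congr' (h : DeltaLim F u x) (huv : ∀ᶠ k in F, u k = v k) : DeltaLim F v x :=
  fun y ε hε => by
    filter_upwards [h y ε hε, huv] with k h1 h2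
    rwa [← h2]

theorem deltaLim_sub_iff : DeltaLim F (fun k => u k - x) 0 ↔ DeltaLim F u x := by
  refine ⟨fun h y ε hε => ?_, fun h y ε hε => ?_⟩
  · filter_upwards [h (y - x) ε hε] with k hk
    rwa [sub_zero, sub_sub_sub_cancel_right] at hk
  · filter_upwards [h (y + x) ε hε] with k hk
    rwa [sub_zero, sub_sub, add_comm x y]

theorem DeltaLim.norm_le_two_mul [F.NeBot] {C : ℝ} (h : DeltaLim F u x)
    (hu : ∀ k, ‖u k‖ ≤ C) : ‖x‖ ≤ 2 * C := by
  refine le_of_forall_pos_le_add fun ε hε => ?_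
  obtain ⟨k, hk⟩ := (h 0 ε hε).exists
  rw [sub_zero] at hk
  have := norm_sub_norm_le x (u k)
  rw [norm_sub_rev] at this
  linarith [hu k]

/-- Uniform limits of `Δ`-null sequences are `Δ`-null. -/
theorem deltaLim_zero_of_forall_exists_near
    (h : ∀ ε : ℝ, 0 < ε → ∃ v : ι → X, DeltaLim F v 0 ∧ ∀ᶠ k in F, ‖u k - v k‖ ≤ ε) :
    DeltaLim F u 0 := by
  intro y ε hε
  obtain ⟨v, hv, huv⟩ := h (ε / 3) (by positivity)
  filter_upwards [hv y (ε / 3) (by positivity), huv] with k h1 h2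
  have h3 := norm_sub_norm_le (u k) (v k)
  have h4 := norm_sub_norm_le (v k - y) (u k - y)
  rw [sub_sub_sub_cancel_right, norm_sub_rev (v k) (u k)] at h4
  rw [sub_zero] at h1 ⊢
  linarith

variable [NormedSpace ℝ X]

theorem norm_add_half_eq (a b : X) : ‖a + b‖ / 2 = ‖(2⁻¹ : ℝ) • (a + b)‖ := by
  rw [norm_smul, Real.norm_of_nonneg (by norm_num)]; ring

/-- If `u` is `Δ`-convergent in the unit ball, then subtracting the limit reduces the norm by at
least the modulus of convexity at the norm of the limit. -/
theorem DeltaLim.norm_sub_add_modulusOfConvexity_le [UniformConvexSpace X] (h : DeltaLim F u x)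
    (hu : ∀ᶠ k in F, ‖u k‖ ≤ 1) :
    (∀ᶠ k in F, ‖u k - x‖ ≤ 1) ∧ ∀ ε : ℝ, 0 < ε →
      ∀ᶠ k in F, ‖u k - x‖ + modulusOfConvexity X ‖x‖ ≤ ‖u k‖ + ε := by
  by_cases hx : x = 0
  · subst hx
    simp only [sub_zero, modulusOfConvexity_norm_zero, add_zero]
    exact ⟨hu, fun ε hε => Eventually.of_forall fun k => by linarith⟩
  have hx' : 0 < ‖x‖ := norm_pos_iff.2 hx
  have hmid : ∀ k, ‖u k - (2⁻¹ : ℝ) • x‖ = ‖u k + (u k - x)‖ / 2 := fun k => by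
    rw [norm_add_half_eq]; congr 1; module
  obtain ⟨η, hη, hUC⟩ := exists_pos_norm_sub_le (X := X) 2 (half_pos hx')
  -- No error term is allowed here, so that iterated subtractions stay in the unit ball. If the
  -- inequality failed, the midpoint competitor and uniform convexity would give `‖x‖ ≤ ‖x‖ / 2`.
  have hlt : ∀ᶠ k in F, ‖u k - x‖ ≤ ‖u k‖ := by
    filter_upwards [hu, h ((2⁻¹ : ℝ) • x) η hη, h 0 1 one_pos] with k h1 h2 h3
    rw [sub_zero] at h3
    by_contra! h4
    rw [hmid] at h2
    have := hUC (u k) (u k - x) (by linarith) (by linarith) h2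
    rw [sub_sub_cancel] at this
    linarith
  refine ⟨by filter_upwards [hlt, hu] with k h1 h2 using h1.trans h2, fun ε hε => ?_⟩
  filter_upwards [hlt, hu, h ((2⁻¹ : ℝ) • x) ε hε] with k h1 h2 h3
  have h4 := norm_add_le_sub_modulusOfConvexity le_rfl h1 h2
  rw [sub_sub_cancel] at h4
  rw [hmid] at h3
  linarith

/-- `Δ`-limits of nearby bounded sequences are close to each other. -/
theorem exists_pos_norm_deltaLim_sub_le [UniformConvexSpace X] (C : ℝ) {ε : ℝ} (hε : 0 < ε) :
    ∃ τ : ℝ, 0 < τ ∧ ∀ (F : Filter ι) (u v : ι → X) (x y : X), F.NeBot → (∀ k, ‖u k‖ ≤ C) →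
      (∀ᶠ k in F, ‖u k - v k‖ ≤ τ) → DeltaLim F u x → DeltaLim F v y → ‖x - y‖ ≤ ε := by
  obtain ⟨η, hη, hUC⟩ := exists_pos_norm_sub_le (X := X) (C + 1) hε
  refine ⟨η / 4, by positivity, fun F u v x y _ hC huv hu hv => ?_⟩
  obtain ⟨k, h1, h2, h3, h4⟩ := (huv.and ((hu 0 1 one_pos).and
    ((hu ((2⁻¹ : ℝ) • (x + y)) η hη).and (hv x (η / 4) (by positivity))))).exists
  rw [sub_zero] at h2
  have h5 : ‖u k - (2⁻¹ : ℝ) • (x + y)‖ = ‖u k - y + (u k - x)‖ / 2 := by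
    rw [norm_add_half_eq]; congr 1; module
  rw [h5] at h3
  have h6 := norm_add_le (u k - v k) (v k - y)
  have h7 := norm_add_le (v k - u k) (u k - x)
  rw [sub_add_sub_cancel] at h6 h7
  rw [norm_sub_rev (v k) (u k)] at h7
  have := hUC (u k - y) (u k - x) (by linarith [hC k]) (by linarith) h3
  rwa [sub_sub_sub_cancel_left] at this

theorem DeltaLim.unique [UniformConvexSpace X] [F.NeBot] {C : ℝ} (hC : ∀ k, ‖u k‖ ≤ C)
    (hx : DeltaLim F u x) (hy : DeltaLim F u y) : x = y := by
  rw [← sub_eq_zero, ← norm_le_zero_iff]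
  refine le_of_forall_pos_le_add fun ε hε => ?_
  obtain ⟨τ, hτ, h⟩ := exists_pos_norm_deltaLim_sub_le (ι := ι) (X := X) C hε
  rw [zero_add]
  exact h F u u x y ‹_› hC (by simp [hτ.le]) hx hy

/-- The asymptotic radius of `u` along the filter `F`. -/
noncomputable def asymptoticRadius (u : ι → X) (F : Filter ι) : ℝ :=
  sInf {ρ : ℝ | ∃ y : X, ∀ᶠ k in F, ‖u k - y‖ ≤ ρ}

omit [NormedSpace ℝ X] in
theorem bddBelow_asymptoticRadius [F.NeBot] :
    BddBelow {ρ : ℝ | ∃ y : X, ∀ᶠ k in F, ‖u k - y‖ ≤ ρ} :=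
  ⟨0, by
    rintro ρ ⟨y, hy⟩
    obtain ⟨k, hk⟩ := hy.exists
    exact (norm_nonneg _).trans hk⟩

omit [NormedSpace ℝ X] in
theorem exists_eventually_norm_sub_le {C : ℝ} (hu : ∀ k, ‖u k‖ ≤ C) {ε : ℝ} (hε : 0 < ε) :
    ∃ y : X, ∀ᶠ k in F, ‖u k - y‖ ≤ asymptoticRadius u F + ε := by
  obtain ⟨ρ, ⟨y, hy⟩, hρ⟩ := exists_lt_of_csInf_lt
    (s := {ρ : ℝ | ∃ y : X, ∀ᶠ k in F, ‖u k - y‖ ≤ ρ}) ⟨C, 0, by simp [hu]⟩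
    (lt_add_of_pos_right _ hε)
  exact ⟨y, hy.mono fun k hk => hk.trans hρ.le⟩

/-- A bounded sequence in a complete uniformly convex space has an asymptotic center. -/
theorem exists_asymptotic_center [CompleteSpace X] [UniformConvexSpace X] [F.NeBot] {C : ℝ}
    (hu : ∀ k, ‖u k‖ ≤ C) :
    ∃ c : X, ∀ ε : ℝ, 0 < ε → ∀ᶠ k in F, ‖u k - c‖ ≤ asymptoticRadius u F + ε := by
  set R := asymptoticRadius u F
  have hpos : ∀ n : ℕ, (0 : ℝ) < 1 / ((n : ℝ) + 1) := fun n => by positivity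
  choose y hy using fun n : ℕ => exists_eventually_norm_sub_le (F := F) hu (hpos n)
  have hcauchy : CauchySeq y := by
    rw [Metric.cauchySeq_iff]
    intro ε hε
    obtain ⟨η, hη, hUC⟩ := exists_pos_norm_sub_le_of_norm_le (X := X) (R + 1) (half_pos hε)
    have hη' : 0 < min 1 (η / 2) := by positivity
    obtain ⟨N, hN⟩ := exists_nat_one_div_lt hη'
    have hle : ∀ n ≥ N, 1 / ((n : ℝ) + 1) ≤ min 1 (η / 2) := fun n hn =>
      (one_div_le_one_div_of_le (by positivity) (by gcongr)).trans hN.le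
    refine ⟨N, fun m hm n hn => ?_⟩
    -- The midpoint of two almost optimal centers cannot beat the asymptotic radius, so uniform
    -- convexity brings these centers together.
    have hfreq : ∃ᶠ k in F, ¬ ‖u k - (2⁻¹ : ℝ) • (y m + y n)‖ ≤ R - η / 2 := by
      intro hev
      have : R ≤ R - η / 2 := csInf_le bddBelow_asymptoticRadius
        ⟨_, (hev.mono fun k hk => not_not.1 hk)⟩
      linarith
    obtain ⟨k, h1, h2, h3⟩ := (hfreq.and_eventually ((hy m).and (hy n))).exists
    have h4 : ‖u k - (2⁻¹ : ℝ) • (y m + y n)‖ = ‖u k - y m + (u k - y n)‖ / 2 := by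
      rw [norm_add_half_eq]; congr 1; module
    rw [h4, not_le] at h1
    have h5 := min_le_left 1 (η / 2)
    have h6 := min_le_right 1 (η / 2)
    have := hUC (u k - y m) (u k - y n) (R + min 1 (η / 2)) (by linarith)
      (by linarith [hle m hm]) (by linarith [hle n hn]) (by linarith)
    rw [sub_sub_sub_cancel_left] at this
    rw [dist_comm, dist_eq_norm]
    linarith
  obtain ⟨c, hc⟩ := cauchySeq_tendsto_of_complete hcauchy
  refine ⟨c, fun ε hε => ?_⟩
  obtain ⟨n, hn1, hn2⟩ := ((hc.eventually (Metric.ball_mem_nhds c (half_pos hε))).and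
    (tendsto_one_div_add_atTop_nhds_zero_nat.eventually (gt_mem_nhds (half_pos hε)))).exists
  filter_upwards [hy n] with k hk
  have h1 := norm_add_le (u k - y n) (y n - c)
  rw [sub_add_sub_cancel] at h1
  rw [dist_eq_norm] at hn1
  linarith

/-- `Δ`-compactness of bounded sequences. -/
theorem exists_le_deltaLim [CompleteSpace X] [UniformConvexSpace X] [F.NeBot]
    [F.IsCountablyGenerated] {C : ℝ} (hu : ∀ k, ‖u k‖ ≤ C) :
    ∃ G ≤ F, G.NeBot ∧ G.IsCountablyGenerated ∧ ∃ x, DeltaLim G u x := by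
  obtain ⟨G, hGF, hGn, hGc, hG⟩ := Filter.exists_le_minimal (F := F) (R := asymptoticRadius u)
    (fun G hG => Real.sInf_nonneg (by
      rintro ρ ⟨y, hy⟩
      obtain ⟨k, hk⟩ := hy.exists
      exact (norm_nonneg _).trans hk))
    (fun G H hG _ hGH => csInf_le_csInf bddBelow_asymptoticRadius ⟨C, 0, by simp [hu]⟩
      (fun ρ ⟨y, hy⟩ => ⟨y, hGH hy⟩))
  obtain ⟨c, hc⟩ := exists_asymptotic_center (F := G) hu
  refine ⟨G, hGF, hGn, hGc, c, fun y ε hε => ?_⟩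
  -- Along a finer filter where `y` beats `c` by `ε`, the asymptotic radius would drop, against the
  -- minimality of `G`.
  by_contra hcon
  obtain ⟨H, hHG, hHn, hHc, hH⟩ := (not_eventually.1 hcon).exists_le_eventually
  have h1 : asymptoticRadius u H ≤ asymptoticRadius u G - ε / 2 := by
    refine csInf_le bddBelow_asymptoticRadius ⟨y, ?_⟩
    filter_upwards [hH, hHG (hc (ε / 2) (half_pos hε))] with k h2 h3
    linarith
  linarith [hG H hHG hHn hHc]

end DeltaLimits

/-! ### Gauges -/

section GaugeFilters

variable {ι 𝕜 X : Type*} [RCLike 𝕜] [NormedAddCommGroup X] [NormedSpace 𝕜 X]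

theorem LinearIsometryEquiv.mul_apply (g h : X ≃ₗᵢ[𝕜] X) (a : X) : (g * h) a = g (h a) := rfl

theorem LinearIsometryEquiv.norm_inv_apply_sub (h : X ≃ₗᵢ[𝕜] X) (a b : X) :
    ‖h⁻¹ a - b‖ = ‖a - h b‖ := by
  rw [← h.norm_map (h⁻¹ a - b), map_sub, ← LinearIsometryEquiv.mul_apply, mul_inv_cancel]
  rfl

theorem LinearIsometryEquiv.norm_inv_apply (h : X ≃ₗᵢ[𝕜] X) (a : X) : ‖h⁻¹ a‖ = ‖a‖ :=
  (h⁻¹).norm_map a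

/-- `g k ⇀ 0` in the weak operator sense along the filter `F`. -/
def WeakOpLim (F : Filter ι) (g : ι → X ≃ₗᵢ[𝕜] X) : Prop :=
  ∀ x : X, Tendsto (fun k => toWeakSpace 𝕜 X (g k x)) F (𝓝 (toWeakSpace 𝕜 X 0))

variable {F : Filter ι} {D₀ : Subgroup (X ≃ₗᵢ[𝕜] X)}

/-- Isometry moves the gauge from the sequence to the competitor; vanishing profiles are used in
this form throughout. -/
theorem deltaLim_inv_iff {h : ι → X ≃ₗᵢ[𝕜] X} {v : ι → X} :
    DeltaLim F (fun k => (h k)⁻¹ (v k)) 0 ↔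
      ∀ y : X, ∀ ε : ℝ, 0 < ε → ∀ᶠ k in F, ‖v k‖ ≤ ‖v k - h k y‖ + ε := by
  simp only [DeltaLim, LinearIsometryEquiv.norm_inv_apply_sub, sub_zero,
    LinearIsometryEquiv.norm_inv_apply]

theorem deltaLim_inv_sub_iff {h : ι → X ≃ₗᵢ[𝕜] X} {v : ι → X} {w : X} :
    DeltaLim F (fun k => (h k)⁻¹ (v k - h k w)) 0 ↔ DeltaLim F (fun k => (h k)⁻¹ (v k)) w := by
  rw [← deltaLim_sub_iff (x := w)]
  have : ∀ k, (h k)⁻¹ (v k - h k w) = (h k)⁻¹ (v k) - w := fun k => by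
    rw [map_sub, ← LinearIsometryEquiv.mul_apply, inv_mul_cancel]
    rfl
  simp only [this]

namespace IsDislocationGroup

theorem exists_le_of_not_weakOpLim (hD₀ : IsDislocationGroup D₀) [F.IsCountablyGenerated]
    {g : ι → X ≃ₗᵢ[𝕜] X} (hg : ∀ k, g k ∈ D₀) (hn : ¬ WeakOpLim F g) :
    ∃ G ≤ F, G.NeBot ∧ (∀ x : X, ∃ y : X, Tendsto (fun k => (g k)⁻¹ x) G (𝓝 y)) ∧
      ∀ x : X, ∃ y : X, Tendsto (fun k => g k x) G (𝓝 y) := by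
  simp only [WeakOpLim, not_forall] at hn
  obtain ⟨x, hx⟩ := hn
  rw [tendsto_iff_seq_tendsto] at hx
  push Not at hx
  obtain ⟨s, hs, hsx⟩ := hx
  obtain ⟨φ, hφ, h1, h2⟩ := hD₀.exists_strongly_convergent (g ∘ s) (fun k => hg _)
    (fun hw => hsx (hw x))
  refine ⟨map (s ∘ φ) atTop, hs.comp hφ.tendsto_atTop, inferInstance, fun x => ?_, fun x => ?_⟩
  · obtain ⟨y, hy⟩ := h1 x
    exact ⟨y, tendsto_map'_iff.2 hy⟩
  · obtain ⟨y, hy⟩ := h2 x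
    exact ⟨y, tendsto_map'_iff.2 hy⟩

theorem deltaLim_add (hD₀ : IsDislocationGroup D₀) [F.IsCountablyGenerated] {u : ι → X} {w : X}
    {g : ι → X ≃ₗᵢ[𝕜] X} (hu : DeltaLim F u 0) (hg : ∀ k, g k ∈ D₀) (hw : WeakOpLim F g) :
    DeltaLim F (fun k => u k + g k w) 0 := by
  intro y ε hε
  rw [eventually_iff_seq_eventually]
  intro s hs
  exact hD₀.deltaTendsto_add (u ∘ s) w (g ∘ s) (fun y ε hε => hs.eventually (hu y ε hε))
    (fun k => hg _) (fun x => (hw x).comp hs) y ε hε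

/-- Adding finitely many elementary concentrations decoupled from the gauge `h` does not affect
the vanishing of the `Δ`-limit at `h`. -/
theorem deltaLim_inv_add_sum (hD₀ : IsDislocationGroup D₀) [F.IsCountablyGenerated] {κ : Type*}
    {h : ι → X ≃ₗᵢ[𝕜] X} {g : κ → ι → X ≃ₗᵢ[𝕜] X} {v : ι → X} {y : κ → X} (J : Finset κ)
    (hh : ∀ k, h k ∈ D₀) (hg : ∀ n k, g n k ∈ D₀) (hv : DeltaLim F (fun k => (h k)⁻¹ (v k)) 0)
    (hJ : ∀ n ∈ J, y n = 0 ∨ WeakOpLim F (fun k => (h k)⁻¹ * g n k)) :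
    DeltaLim F (fun k => (h k)⁻¹ (v k + ∑ n ∈ J, g n k (y n))) 0 := by
  classical
  induction J using Finset.induction_on with
  | empty => simpa using hv
  | insert j J hj ih =>
    have ih' := ih fun n hn => hJ n (Finset.mem_insert_of_mem hn)
    rcases hJ j (Finset.mem_insert_self j J) with h0 | h0
    · simpa [Finset.sum_insert hj, h0] using ih'
    · have := hD₀.deltaLim_add (w := y j) ih' (fun k => D₀.mul_mem (D₀.inv_mem (hh k)) (hg j k)) h0
      refine this.congr' (Eventually.of_forall fun k => ?_)
      rw [Finset.sum_insert hj, LinearIsometryEquiv.mul_apply, ← map_add]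
      congr 1
      abel

/-- Adding decoupled concentrations at gauges where `v` has zero `Δ`-limit asymptotically does
not decrease the norm. -/
theorem eventually_norm_le_norm_add_sum (hD₀ : IsDislocationGroup D₀) [F.IsCountablyGenerated]
    {κ : Type*} {g : κ → ι → X ≃ₗᵢ[𝕜] X} {v : ι → X} {y : κ → X} (J : Finset κ)
    (hg : ∀ n k, g n k ∈ D₀)
    (hv : ∀ n ∈ J, y n ≠ 0 → DeltaLim F (fun k => (g n k)⁻¹ (v k)) 0)
    (hJ : ∀ n ∈ J, ∀ m ∈ J, m ≠ n → y n ≠ 0 → y m ≠ 0 →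
      WeakOpLim F (fun k => (g n k)⁻¹ * g m k))
    {ε : ℝ} (hε : 0 < ε) :
    ∀ᶠ k in F, ‖v k‖ ≤ ‖v k + ∑ n ∈ J, g n k (y n)‖ + ε := by
  classical
  induction J using Finset.induction_on generalizing ε with
  | empty => simp [hε.le]
  | insert j J hj ih =>
    have h1 := fun {ε : ℝ} => ih (fun n hn => hv n (Finset.mem_insert_of_mem hn))
      (fun n hn m hm => hJ n (Finset.mem_insert_of_mem hn) m (Finset.mem_insert_of_mem hm)) (ε := ε)
    by_cases h0 : y j = 0
    · simpa [Finset.sum_insert hj, h0] using h1 hε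
    have hjJ := Finset.mem_insert_self j J
    have h2 := hD₀.deltaLim_inv_add_sum J (hg j) hg (hv j hjJ h0)
      fun m hm => or_iff_not_imp_left.2 fun hm0 => hJ j hjJ m (Finset.mem_insert_of_mem hm)
        (by rintro rfl; exact hj hm) h0 hm0
    filter_upwards [h1 (half_pos hε), deltaLim_inv_iff.1 h2 (-y j) (ε / 2) (half_pos hε)]
      with k h3 h4
    rw [Finset.sum_insert hj]
    rw [map_neg, sub_neg_eq_add, add_assoc, add_comm (∑ n ∈ J, g n k (y n))] at h4
    linarith

variable [NormedSpace ℝ X] [UniformConvexSpace X]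

/-- A gauge with a nonzero profile is decoupled from a gauge at which the profile is zero. -/
theorem weakOpLim_of_deltaLim (hD₀ : IsDislocationGroup D₀) [F.IsCountablyGenerated]
    {g h : ι → X ≃ₗᵢ[𝕜] X} {v : ι → X} {w : X} {C : ℝ} (hg : ∀ k, g k ∈ D₀) (hh : ∀ k, h k ∈ D₀)
    (hC : ∀ k, ‖v k‖ ≤ C) (hgv : DeltaLim F (fun k => (g k)⁻¹ (v k)) 0)
    (hhv : DeltaLim F (fun k => (h k)⁻¹ (v k)) w) (hw : w ≠ 0) :
    WeakOpLim F (fun k => (h k)⁻¹ * g k) ∧ WeakOpLim F (fun k => (g k)⁻¹ * h k) := by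
  -- Where `(g k)⁻¹ * h k` converges strongly, `h k y` is close to `g k z` for a fixed `z`. The zero
  -- profile at `g` then passes to `h`, against uniqueness of Δ-limits.
  have key : ∀ G ≤ F, G.NeBot →
      ¬ ∀ x : X, ∃ y : X, Tendsto (fun k => ((g k)⁻¹ * h k) x) G (𝓝 y) := by
    intro G hGF hGn hG
    refine hw (DeltaLim.unique (F := G) (u := fun k => (h k)⁻¹ (v k)) (C := C)
      (fun k => ((h k).norm_inv_apply _).trans_le (hC k)) (hhv.mono hGF) ?_)
    rw [deltaLim_inv_iff]
    intro y ε hε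
    obtain ⟨z, hz⟩ := hG y
    have hball := hz.eventually (Metric.ball_mem_nhds z (half_pos hε))
    filter_upwards [hball, hGF (deltaLim_inv_iff.1 hgv z (ε / 2) (half_pos hε))] with k h1 h2
    have h3 : ‖h k y - g k z‖ < ε / 2 := by
      rw [dist_eq_norm, LinearIsometryEquiv.mul_apply,
        LinearIsometryEquiv.norm_inv_apply_sub] at h1
      exact h1
    have h4 := norm_add_le (v k - h k y) (h k y - g k z)
    rw [sub_add_sub_cancel] at h4
    linarith
  have hinv : ∀ k, ((h k)⁻¹ * g k)⁻¹ = (g k)⁻¹ * h k := fun k => by group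
  constructor
  · by_contra hn
    obtain ⟨G, hGF, hGn, h1, -⟩ := hD₀.exists_le_of_not_weakOpLim
      (fun k => D₀.mul_mem (D₀.inv_mem (hh k)) (hg k)) hn
    simp only [hinv] at h1
    exact key G hGF hGn h1
  · by_contra hn
    obtain ⟨G, hGF, hGn, -, h1⟩ := hD₀.exists_le_of_not_weakOpLim
      (fun k => D₀.mul_mem (D₀.inv_mem (hg k)) (hh k)) hn
    exact key G hGF hGn h1

end IsDislocationGroup

end GaugeFilters

/-! ### Properties of a given decomposition -/

namespace IsDeltaProfileDecomposition

variable {𝕜 X : Type*} [RCLike 𝕜] [NormedAddCommGroup X] [NormedSpace 𝕜 X]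
  {D₀ : Subgroup (X ≃ₗᵢ[𝕜] X)} {D : Set (X ≃ₗᵢ[𝕜] X)} {x : ℕ → X} {φ : ℕ → ℕ} {N : ℕ∞}
  {g : ℕ → ℕ → X ≃ₗᵢ[𝕜] X} {w r : ℕ → X}

theorem eventually_norm_sub_le (h : IsDeltaProfileDecomposition D x φ N g w r) {ε : ℝ}
    (hε : 0 < ε) : ∀ᶠ s : Finset ℕ in atTop, ∀ k,
      ‖x (φ k) - ∑ n ∈ s, g n k (w n) - r k‖ ≤ ε := by
  filter_upwards [Metric.tendstoUniformly_iff.1 h.uniform ε hε] with s hs k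
  rw [h.eq_add, add_sub_right_comm, add_sub_cancel_right, ← dist_eq_norm]
  exact (hs k).le

/-- The remainder is null at every gauge and finitely many other concentrations are decoupled from
this one. Uniform convergence then handles the full series. -/
theorem deltaLim_gauge (hD₀ : IsDislocationGroup D₀) (hD : D ⊆ (D₀ : Set (X ≃ₗᵢ[𝕜] X)))
    (h : IsDeltaProfileDecomposition D x φ N g w r) {n : ℕ} (hn : (n : ℕ∞) < N) :
    DeltaLim atTop (fun k => (g n k)⁻¹ (x (φ k))) (w n) := by
  classical
  rw [← deltaLim_inv_sub_iff]
  refine deltaLim_zero_of_forall_exists_near fun ε hε => ?_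
  obtain ⟨s, hs, hns⟩ := ((h.eventually_norm_sub_le hε).and (eventually_ge_atTop {n})).exists
  have hns : n ∈ s := Finset.singleton_subset_iff.1 hns
  have hr : DeltaLim atTop (fun k => (g n k)⁻¹ (r k)) 0 := by
    have := h.remainder (g n) (h.gauge_mem n)
    simp only [sub_zero] at this
    exact this
  refine ⟨_, hD₀.deltaLim_inv_add_sum (s.erase n) (fun k => hD (h.gauge_mem n k))
    (fun m k => hD (h.gauge_mem m k)) (y := w) hr fun m hm => ?_, Eventually.of_forall fun k => ?_⟩
  · by_cases hmN : N ≤ m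
    · exact Or.inl (h.profile_eq_zero m hmN)
    · exact Or.inr (h.decoupled m n (not_le.1 hmN) hn (Finset.ne_of_mem_erase hm))
  · rw [← map_sub, LinearIsometryEquiv.norm_inv_apply]
    convert hs k using 2
    rw [← Finset.add_sum_erase s _ hns]
    abel

theorem deltaLim_gauge_sub_sum (hD₀ : IsDislocationGroup D₀)
    (hD : D ⊆ (D₀ : Set (X ≃ₗᵢ[𝕜] X))) (h : IsDeltaProfileDecomposition D x φ N g w r) {n : ℕ}
    (hn : (n : ℕ∞) < N) :
    DeltaLim atTop (fun k => (g n k)⁻¹ (x (φ k) - ∑ m ∈ Finset.range n, g m k (w m))) (w n) := by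
  rw [← deltaLim_inv_sub_iff]
  have h0 := deltaLim_inv_sub_iff.2 (h.deltaLim_gauge hD₀ hD hn)
  refine (hD₀.deltaLim_inv_add_sum (y := fun m => - w m) (Finset.range n)
    (fun k => hD (h.gauge_mem n k)) (fun m k => hD (h.gauge_mem m k)) h0 fun m hm => ?_).congr'
    (Eventually.of_forall fun k => ?_)
  · have hmn : m < n := Finset.mem_range.1 hm
    exact Or.inr (h.decoupled m n ((Nat.cast_lt.2 hmn).trans hn) hn hmn.ne)
  · simp only [map_neg, Finset.sum_neg_distrib]
    congr 1
    abel

theorem norm_profile_le (hD₀ : IsDislocationGroup D₀) (hD : D ⊆ (D₀ : Set (X ≃ₗᵢ[𝕜] X)))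
    (h : IsDeltaProfileDecomposition D x φ N g w r) (hx : ∀ k, ‖x k‖ ≤ 1) (n : ℕ) :
    ‖w n‖ ≤ 2 := by
  by_cases hn : N ≤ n
  · rw [h.profile_eq_zero n hn, norm_zero]; exact zero_le_two
  · have := (h.deltaLim_gauge hD₀ hD (not_le.1 hn)).norm_le_two_mul (C := 1)
      fun k => ((g n k).norm_inv_apply _).trans_le (hx _)
    linarith

variable [NormedSpace ℝ X] [UniformConvexSpace X]

/-- Induction on the number of subtracted profiles. The first conjunct keeps the partial remainder
in the unit ball, where the next subtraction costs its modulus of convexity. -/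
theorem eventually_norm_sub_sum_add_le (hD₀ : IsDislocationGroup D₀)
    (hD : D ⊆ (D₀ : Set (X ≃ₗᵢ[𝕜] X))) (h : IsDeltaProfileDecomposition D x φ N g w r)
    (hx : ∀ k, ‖x k‖ ≤ 1) (M : ℕ) :
    (∀ᶠ k in atTop, ‖x (φ k) - ∑ m ∈ Finset.range M, g m k (w m)‖ ≤ 1) ∧
      ∀ ε : ℝ, 0 < ε → ∀ᶠ k in atTop, ‖x (φ k) - ∑ m ∈ Finset.range M, g m k (w m)‖ +
        ∑ m ∈ Finset.range M, modulusOfConvexity X ‖w m‖ ≤ 1 + ε := by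
  induction M with
  | zero =>
    simp only [Finset.range_zero, Finset.sum_empty, sub_zero, add_zero]
    exact ⟨Eventually.of_forall fun k => hx _, fun ε hε =>
      Eventually.of_forall fun k => (hx _).trans (by linarith)⟩
  | succ M ih =>
    by_cases hM : N ≤ M
    · simpa only [Finset.sum_range_succ, h.profile_eq_zero M hM, map_zero, add_zero,
        modulusOfConvexity_norm_zero] using ih
    · have h1 := (h.deltaLim_gauge_sub_sum hD₀ hD (not_le.1 hM)).norm_sub_add_modulusOfConvexity_le
        (ih.1.mono fun k hk => ((g M k).norm_inv_apply _).trans_le hk)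
      simp only [LinearIsometryEquiv.norm_inv_apply_sub, LinearIsometryEquiv.norm_inv_apply,
        sub_sub] at h1
      simp only [Finset.sum_range_succ]
      refine ⟨h1.1, fun ε hε => ?_⟩
      filter_upwards [h1.2 (ε / 2) (half_pos hε), ih.2 (ε / 2) (half_pos hε)] with k h2 h3
      linarith

theorem limsup_enorm_add_tsum_le (hD₀ : IsDislocationGroup D₀)
    (hD : D ⊆ (D₀ : Set (X ≃ₗᵢ[𝕜] X))) (h : IsDeltaProfileDecomposition D x φ N g w r)
    (hx : ∀ k, ‖x k‖ ≤ 1) :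
    limsup (fun k => ‖r k‖ₑ) atTop + ∑' n, ENNReal.ofReal (modulusOfConvexity X ‖w n‖) ≤ 1 := by
  have key : ∀ M : ℕ, limsup (fun k => ‖r k‖ₑ) atTop +
      ∑ n ∈ Finset.range M, ENNReal.ofReal (modulusOfConvexity X ‖w n‖) ≤ 1 := by
    intro M
    have hnn : ∀ n : ℕ, 0 ≤ modulusOfConvexity X ‖w n‖ := fun n => modulusOfConvexity_nonneg _
    rw [← ENNReal.ofReal_sum_of_nonneg fun n _ => hnn n]
    set S := ∑ n ∈ Finset.range M, modulusOfConvexity X ‖w n‖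
    have hr : ∀ ε : ℝ, 0 < ε → ∀ᶠ k in atTop, ‖r k‖ + S ≤ 1 + ε := by
      intro ε hε
      obtain ⟨M', hM', hMM'⟩ := ((tendsto_finset_range.eventually
        (h.eventually_norm_sub_le (half_pos hε))).and (eventually_ge_atTop M)).exists
      filter_upwards [(h.eventually_norm_sub_sum_add_le hD₀ hD hx M').2 (ε / 2) (half_pos hε)]
        with k hk
      have h1 : S ≤ ∑ n ∈ Finset.range M', modulusOfConvexity X ‖w n‖ :=
        Finset.sum_le_sum_of_subset_of_nonneg (Finset.range_mono hMM') fun n _ _ => hnn n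
      have h2 := norm_sub_norm_le (r k) (x (φ k) - ∑ m ∈ Finset.range M', g m k (w m))
      have h3 := hM' k
      rw [norm_sub_rev] at h3
      linarith
    have hS1 : S ≤ 1 := le_of_forall_pos_le_add fun ε hε => by
      obtain ⟨k, hk⟩ := (hr ε hε).exists
      linarith [norm_nonneg (r k)]
    have hS0 : 0 ≤ S := Finset.sum_nonneg fun n _ => hnn n
    have hlim : limsup (fun k => ‖r k‖ₑ) atTop ≤ ENNReal.ofReal (1 - S) := by
      refine ENNReal.le_of_forall_pos_le_add fun ε hε _ => ?_
      refine limsup_le_of_le (h := ?_)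
      filter_upwards [hr ε hε] with k hk
      rw [← ofReal_norm, ← ENNReal.ofReal_coe_nnreal,
        ← ENNReal.ofReal_add (sub_nonneg.2 hS1) ε.coe_nonneg]
      exact ENNReal.ofReal_le_ofReal (by linarith)
    calc _ ≤ ENNReal.ofReal (1 - S) + ENNReal.ofReal S := by gcongr
      _ = 1 := by rw [← ENNReal.ofReal_add (by linarith) hS0, sub_add_cancel, ENNReal.ofReal_one]
  rw [ENNReal.tsum_eq_iSup_nat, ENNReal.add_iSup]
  exact iSup_le key

end IsDeltaProfileDecomposition

/-! ### Uniform unconditional summability -/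

section UniformSummability

variable {ι κ X : Type*} [NormedAddCommGroup X]

theorem summable_and_tendstoUniformly_of_forall_norm_sum_le [CompleteSpace X] {f : ι → κ → X}
    (h : ∀ ε : ℝ, 0 < ε → ∃ s : Finset ι, ∀ J : Finset ι, Disjoint J s →
      ∀ k, ‖∑ n ∈ J, f n k‖ ≤ ε) :
    (∀ k, Summable fun n => f n k) ∧
      TendstoUniformly (fun (s : Finset ι) (k : κ) => ∑ n ∈ s, f n k)
        (fun k => ∑' n, f n k) atTop := by
  classical
  have hs : ∀ k, Summable fun n => f n k := fun k => by
    rw [summable_iff_vanishing_norm]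
    intro ε hε
    obtain ⟨s, hs⟩ := h (ε / 2) (half_pos hε)
    exact ⟨s, fun t ht => (hs t ht k).trans_lt (half_lt_self hε)⟩
  refine ⟨hs, Metric.tendstoUniformly_iff.2 fun ε hε => ?_⟩
  obtain ⟨s, hsε⟩ := h (ε / 2) (half_pos hε)
  filter_upwards [eventually_ge_atTop s] with t ht k
  rw [dist_eq_norm]
  refine lt_of_le_of_lt ?_ (half_lt_self hε)
  refine le_of_tendsto ((hs k).hasSum.sub_const (∑ n ∈ t, f n k)).norm ?_
  filter_upwards [eventually_ge_atTop t] with t' ht'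
  rw [← Finset.sum_sdiff ht', add_sub_cancel_right]
  exact hsε _ (Finset.sdiff_disjoint.mono_right ht) k

/-- If the tails of a series of sequences are asymptotically small, then finitely many values of
each term can be modified so that the tails become uniformly small. -/
theorem exists_max_forall_norm_sum_le {f : ℕ → ℕ → X}
    (h : ∀ ε : ℝ, 0 < ε → ∃ n₀, ∀ J : Finset ℕ, (∀ n ∈ J, n₀ ≤ n) →
      ∀ᶠ k in atTop, ‖∑ n ∈ J, f n k‖ ≤ ε) :
    ∃ K : ℕ → ℕ, ∀ ε : ℝ, 0 < ε → ∃ s : Finset ℕ, ∀ J : Finset ℕ, Disjoint J s →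
      ∀ k, ‖∑ n ∈ J, f n (max k (K n))‖ ≤ ε := by
  classical
  choose b hb using fun i : ℕ => h ((1 / 2) ^ i) (by positivity)
  -- `β n` is the number of the block that contains `n`
  let β : ℕ → ℕ := fun n => Nat.findGreatest (fun i => b i ≤ n) n
  have hβle : ∀ n, β n ≠ 0 → b (β n) ≤ n := fun n hn =>
    Nat.findGreatest_of_ne_zero (P := fun i => b i ≤ n) rfl hn
  have hβge : ∀ i n, i ≤ n → b i ≤ n → i ≤ β n := fun i n h1 h2 => Nat.le_findGreatest h1 h2
  let T : ℕ → ℕ := fun i => max i (b i)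
  have hT : ∀ i n, β n < i → n < T i := fun i n hn => by
    by_contra! hcon
    exact absurd (hβge i n ((le_max_left _ _).trans hcon) ((le_max_right _ _).trans hcon))
      (not_le.2 hn)
  -- Blocks are finite, so one threshold `k₀ i` serves all subsets of block `i`; the block bounds
  -- sum geometrically.
  let B : ℕ → Finset ℕ := fun i => (Finset.range (T (i + 1))).filter fun n => β n = i
  have hB : ∀ i, ∃ k₀, ∀ k ≥ k₀, ∀ J ∈ (B i).powerset, i ≠ 0 →
      ‖∑ n ∈ J, f n k‖ ≤ (1 / 2) ^ i := fun i => by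
    refine eventually_atTop.1 ((Finset.eventually_all _).2 fun J hJ => ?_)
    by_cases hi : i = 0
    · exact Eventually.of_forall fun k h0 => absurd hi h0
    · refine (hb i J fun n hn => ?_).mono fun k hk _ => hk
      have := (Finset.mem_filter.1 (Finset.mem_powerset.1 hJ hn)).2
      subst this
      exact hβle n hi
  choose k₀ hk₀ using hB
  refine ⟨fun n => k₀ (β n), fun ε hε => ?_⟩
  obtain ⟨i₀, hi₀⟩ := exists_pow_lt_of_lt_one hε (show (1 / 2 : ℝ) < 1 by norm_num)
  refine ⟨Finset.range (T (i₀ + 2)), fun J hJ k => ?_⟩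
  have hJβ : ∀ n ∈ J, i₀ + 2 ≤ β n := fun n hn => by
    by_contra! hcon
    exact Finset.disjoint_left.1 hJ hn (Finset.mem_range.2 (hT _ _ hcon))
  rw [← Finset.sum_fiberwise_of_maps_to (fun n hn => Finset.mem_image_of_mem β hn)]
  have hblock : ∀ i ∈ J.image β, ‖∑ n ∈ J with β n = i, f n (max k (k₀ (β n)))‖ ≤ (1 / 2) ^ i := by
    intro i hi
    obtain ⟨n, hn, rfl⟩ := Finset.mem_image.1 hi
    have heq : ∑ m ∈ J with β m = β n, f m (max k (k₀ (β m))) =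
        ∑ m ∈ J with β m = β n, f m (max k (k₀ (β n))) :=
      Finset.sum_congr rfl fun m hm => by rw [(Finset.mem_filter.1 hm).2]
    rw [heq]
    refine hk₀ (β n) _ (le_max_right _ _) _ (Finset.mem_powerset.2 fun m hm => ?_)
      (by have := hJβ n hn; omega)
    have hm' := (Finset.mem_filter.1 hm).2
    exact Finset.mem_filter.2 ⟨Finset.mem_range.2 (hT _ _ (by omega)), hm'⟩
  have hgeom : ∑ i ∈ J.image β, (1 / 2 : ℝ) ^ i ≤ (1 / 2) ^ (i₀ + 2) * 2 := by
    have hsum : Summable fun i : ℕ => (1 / 2 : ℝ) ^ (i₀ + 2) * (1 / 2) ^ i :=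
      summable_geometric_two.mul_left _
    have := hsum.sum_le_tsum ((J.image β).image fun i => i - (i₀ + 2)) fun i _ => by positivity
    rw [tsum_mul_left, tsum_geometric_two] at this
    have hge : ∀ i ∈ J.image β, i₀ + 2 ≤ i := fun i hi => by
      obtain ⟨n, hn, rfl⟩ := Finset.mem_image.1 hi
      exact hJβ n hn
    have hinj : Set.InjOn (fun i => i - (i₀ + 2)) (J.image β : Finset ℕ) := fun i hi j hj hij => by
      have h1 := hge i hi
      have h2 := hge j hj
      dsimp only at hij
      omega
    rw [Finset.sum_image hinj] at this
    refine le_trans (le_of_eq (Finset.sum_congr rfl fun i hi => ?_)) this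
    rw [← pow_add, Nat.add_sub_cancel' (hge i hi)]
  refine (norm_sum_le_of_le _ hblock).trans (hgeom.trans ?_)
  rw [pow_add]
  norm_num at hi₀ ⊢
  linarith [show (0 : ℝ) < (1 / 2) ^ i₀ by positivity]

end UniformSummability

/-! ### Extraction of profiles -/

/-- Successive almost maximal profiles `w n` of a sequence `x`, with gauges `h n` and remainders
`v n`, along a filter `F` (which plays the role of a subsequence). -/
structure IsProfileExtraction {𝕜 X : Type*} [RCLike 𝕜] [NormedAddCommGroup X] [NormedSpace 𝕜 X]
    (D : Set (X ≃ₗᵢ[𝕜] X)) (F : Filter ℕ) (x : ℕ → X) (h : ℕ → ℕ → X ≃ₗᵢ[𝕜] X) (w : ℕ → X)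
    (v : ℕ → ℕ → X) : Prop where
  gauge_mem : ∀ n k, h n k ∈ D
  gauge_zero : ∀ k, h 0 k = 1
  remainder_zero : v 0 = x
  remainder_succ : ∀ n k, v (n + 1) k = v n k - h n k (w n)
  remainder_bounded : ∀ n, ∃ C : ℝ, ∀ k, ‖v n k‖ ≤ C
  deltaLim : ∀ n, DeltaLim F (fun k => (h n k)⁻¹ (v n k)) (w n)
  tendsto_norm : ∀ n, ∃ c : ℝ, Tendsto (fun k => ‖v n k‖) F (𝓝 c)
  norm_le : ∀ n, ∀ G ≤ F, G.NeBot → G.IsCountablyGenerated → ∀ h' : ℕ → X ≃ₗᵢ[𝕜] X,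
    (∀ k, h' k ∈ D) → ∀ w' : X, DeltaLim G (fun k => (h' k)⁻¹ (v (n + 1) k)) w' →
    ‖w'‖ ≤ 2 * ‖w (n + 1)‖

section Extraction

variable {𝕜 X : Type*} [RCLike 𝕜] [NormedAddCommGroup X] [NormedSpace 𝕜 X] [NormedSpace ℝ X]
  [UniformConvexSpace X] {D : Set (X ≃ₗᵢ[𝕜] X)} {F : Filter ℕ}

/-- The supremum of profile norms need not be attained, hence the factor 2. -/
theorem exists_almost_maximal_profile [CompleteSpace X] [F.NeBot] [F.IsCountablyGenerated]
    (hD1 : 1 ∈ D) {v : ℕ → X} {C : ℝ} (hv : ∀ k, ‖v k‖ ≤ C) :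
    ∃ G ≤ F, G.NeBot ∧ G.IsCountablyGenerated ∧ ∃ h : ℕ → X ≃ₗᵢ[𝕜] X, (∀ k, h k ∈ D) ∧
      ∃ w, DeltaLim G (fun k => (h k)⁻¹ (v k)) w ∧
      ∀ G' ≤ F, G'.NeBot → G'.IsCountablyGenerated → ∀ h' : ℕ → X ≃ₗᵢ[𝕜] X,
        (∀ k, h' k ∈ D) → ∀ w' : X, DeltaLim G' (fun k => (h' k)⁻¹ (v k)) w' →
        ‖w'‖ ≤ 2 * ‖w‖ := by
  let A : Set ℝ := {t | ∃ G ≤ F, G.NeBot ∧ G.IsCountablyGenerated ∧ ∃ h : ℕ → X ≃ₗᵢ[𝕜] X,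
    (∀ k, h k ∈ D) ∧ ∃ w, DeltaLim G (fun k => (h k)⁻¹ (v k)) w ∧ ‖w‖ = t}
  have hA : A.Nonempty := by
    obtain ⟨G, hG, hGn, hGc, w, hw⟩ := exists_le_deltaLim (F := F) hv
    exact ⟨_, G, hG, hGn, hGc, fun _ => 1, fun _ => hD1, w, by simpa using hw, rfl⟩
  have hb : BddAbove A := ⟨2 * C, by
    rintro _ ⟨G, -, hGn, -, h, -, w, hw, rfl⟩
    exact hw.norm_le_two_mul fun k => ((h k).norm_inv_apply _).trans_le (hv k)⟩
  obtain ⟨t, ⟨G, hG, hGn, hGc, h, hh, w, hw, rfl⟩, hlt⟩ : ∃ t ∈ A, sSup A ≤ 2 * t := by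
    obtain ⟨t₀, ht₀⟩ := hA
    have h0 : 0 ≤ t₀ := by
      obtain ⟨-, -, -, -, -, -, w, -, rfl⟩ := ht₀
      exact norm_nonneg w
    rcases le_or_gt (sSup A) 0 with hs | hs
    · exact ⟨t₀, ht₀, by linarith⟩
    · obtain ⟨t, ht, hlt⟩ := exists_lt_of_lt_csSup ⟨t₀, ht₀⟩ (half_lt_self hs)
      exact ⟨t, ht, by linarith⟩
  exact ⟨G, hG, hGn, hGc, h, hh, w, hw, fun G' hG' hGn' hGc' h' hh' w' hw' =>
    (le_csSup hb ⟨G', hG', hGn', hGc', h', hh', w', hw', rfl⟩).trans hlt⟩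

theorem exists_isProfileExtraction [CompleteSpace X] (hD1 : 1 ∈ D) {x : ℕ → X} {C : ℝ}
    (hx : ∀ k, ‖x k‖ ≤ C) :
    ∃ F ≤ (atTop : Filter ℕ), F.NeBot ∧ F.IsCountablyGenerated ∧
      ∃ (h : ℕ → ℕ → X ≃ₗᵢ[𝕜] X) (w : ℕ → X) (v : ℕ → ℕ → X), IsProfileExtraction D F x h w v := by
  let S := {s : Filter ℕ × (ℕ → X) × (ℕ → X ≃ₗᵢ[𝕜] X) × X //
    s.1.NeBot ∧ s.1.IsCountablyGenerated ∧ ∃ C : ℝ, ∀ k, ‖s.2.1 k‖ ≤ C}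
  let R : ℕ → S → S → Prop := fun n s t => t.1.1 ≤ s.1.1 ∧ (∀ k, t.1.2.2.1 k ∈ D) ∧
    (n = 0 → ∀ k, t.1.2.2.1 k = 1) ∧
    (∀ k, t.1.2.1 k = s.1.2.1 k - t.1.2.2.1 k t.1.2.2.2) ∧
    DeltaLim t.1.1 (fun k => (t.1.2.2.1 k)⁻¹ (s.1.2.1 k)) t.1.2.2.2 ∧
    (∃ c : ℝ, Tendsto (fun k => ‖s.1.2.1 k‖) t.1.1 (𝓝 c)) ∧
    (n ≠ 0 → ∀ G ≤ s.1.1, G.NeBot → G.IsCountablyGenerated → ∀ h' : ℕ → X ≃ₗᵢ[𝕜] X,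
      (∀ k, h' k ∈ D) → ∀ w' : X, DeltaLim G (fun k => (h' k)⁻¹ (s.1.2.1 k)) w' →
      ‖w'‖ ≤ 2 * ‖t.1.2.2.2‖)
  have step : ∀ (n : ℕ) (s : S), ∃ t : S, R n s t := by
    rintro n ⟨⟨F, v, -, -⟩, hFn, hFc, C, hC⟩
    dsimp only at hFn hFc hC
    have habs : ∀ k, |‖v k‖| ≤ C := fun k => (abs_norm (v k)).trans_le (hC k)
    have hbound : ∀ (h : ℕ → X ≃ₗᵢ[𝕜] X) (w : X) (k : ℕ), ‖v k - h k w‖ ≤ C + ‖w‖ :=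
      fun h w k => (norm_sub_le _ _).trans (by rw [(h k).norm_map]; linarith [hC k])
    -- The initial gauge is forced to be the identity, so almost maximality is available only from
    -- index 1 on.
    by_cases hn : n = 0
    · obtain ⟨G', hG', hGn', hGc', w, hw⟩ := exists_le_deltaLim (F := F) hC
      obtain ⟨G, hG, hGn, hGc, c, hc⟩ := Filter.exists_le_tendsto_of_bounded (F := G') habs
      refine ⟨⟨⟨G, fun k => v k - (1 : X ≃ₗᵢ[𝕜] X) w, fun _ => 1, w⟩, hGn, hGc, _,
        hbound (fun _ => 1) w⟩, hG.trans hG', fun _ => hD1, fun _ _ => rfl, fun _ => rfl, ?_,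
        ⟨c, hc⟩, fun h0 => absurd hn h0⟩
      simpa using hw.mono hG
    · obtain ⟨G', hG', hGn', hGc', h, hh, w, hw, hmax⟩ :=
        exists_almost_maximal_profile (F := F) hD1 hC
      obtain ⟨G, hG, hGn, hGc, c, hc⟩ := Filter.exists_le_tendsto_of_bounded (F := G') habs
      exact ⟨⟨⟨G, fun k => v k - h k w, h, w⟩, hGn, hGc, _, hbound h w⟩, hG.trans hG', hh,
        fun h0 => absurd h0 hn, fun _ => rfl, hw.mono hG, ⟨c, hc⟩, fun _ => hmax⟩
  obtain ⟨f, hf0, hf⟩ := exists_seq_of_forall_exists step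
    ⟨⟨atTop, x, fun _ => 1, 0⟩, atTop_neBot, inferInstance, C, hx⟩
  obtain ⟨F, hFn, hFc, hF⟩ := Filter.exists_le_forall_le (f := fun n => (f n).1.1)
    (fun n => (hf n).1) (fun n => (f n).2.1) (fun n => (f n).2.2.1)
  refine ⟨F, (hF 0).trans (by simp only [hf0, le_refl]), hFn, hFc, fun n => (f (n + 1)).1.2.2.1,
    fun n => (f (n + 1)).1.2.2.2, fun n => (f n).1.2.1, ?_⟩
  exact
    { gauge_mem := fun n => (hf n).2.1
      gauge_zero := (hf 0).2.2.1 rfl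
      remainder_zero := by simp only [hf0]
      remainder_succ := fun n => (hf n).2.2.2.1
      remainder_bounded := fun n => (f n).2.2.2
      deltaLim := fun n => (hf n).2.2.2.2.1.mono (hF (n + 1))
      tendsto_norm := fun n => by
        obtain ⟨c, hc⟩ := (hf n).2.2.2.2.2.1
        exact ⟨c, hc.mono_left (hF (n + 1))⟩
      norm_le := fun n G hG => (hf (n + 1)).2.2.2.2.2.2 (Nat.succ_ne_zero n) G
        (hG.trans (hF (n + 1))) }

namespace IsProfileExtraction

variable {D₀ : Subgroup (X ≃ₗᵢ[𝕜] X)} {x : ℕ → X} {h : ℕ → ℕ → X ≃ₗᵢ[𝕜] X} {w : ℕ → X}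
  {v : ℕ → ℕ → X} [F.IsCountablyGenerated]

omit [NormedSpace ℝ X] [UniformConvexSpace X] [F.IsCountablyGenerated] in
theorem remainder_add_sum (E : IsProfileExtraction D F x h w v) {n m : ℕ} (hnm : n ≤ m) (k : ℕ) :
    v m k + ∑ i ∈ Finset.Ico n m, h i k (w i) = v n k := by
  induction m, hnm using Nat.le_induction with
  | base => simp
  | succ m hm ih =>
    rw [Finset.sum_Ico_succ_top hm, E.remainder_succ, ← ih]
    abel

theorem deltaLim_zero (E : IsProfileExtraction D F x h w v) (hD₀ : IsDislocationGroup D₀)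
    (hD : D ⊆ (D₀ : Set (X ≃ₗᵢ[𝕜] X))) {m n : ℕ} (hmn : m < n) :
    DeltaLim F (fun k => (h m k)⁻¹ (v n k)) 0 := by
  induction n, hmn using Nat.le_induction with
  | base =>
    simp only [E.remainder_succ]
    exact deltaLim_inv_sub_iff.2 (E.deltaLim m)
  | succ n hmn ih =>
    by_cases hw : w n = 0
    · simpa only [E.remainder_succ, hw, map_zero, sub_zero] using ih
    · obtain ⟨C, hC⟩ := E.remainder_bounded n
      have hweak := (hD₀.weakOpLim_of_deltaLim (fun k => hD (E.gauge_mem m k))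
        (fun k => hD (E.gauge_mem n k)) hC ih (E.deltaLim n) hw).2
      refine (hD₀.deltaLim_add (w := -w n) ih (fun k => D₀.mul_mem (D₀.inv_mem
        (hD (E.gauge_mem m k))) (hD (E.gauge_mem n k))) hweak).congr'
        (Eventually.of_forall fun k => ?_)
      rw [E.remainder_succ, map_neg, ← sub_eq_add_neg, LinearIsometryEquiv.mul_apply, ← map_sub]

theorem decoupled (E : IsProfileExtraction D F x h w v) (hD₀ : IsDislocationGroup D₀)
    (hD : D ⊆ (D₀ : Set (X ≃ₗᵢ[𝕜] X))) {m n : ℕ} (hmn : m ≠ n) (hm : m = 0 ∨ w m ≠ 0)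
    (hn : n = 0 ∨ w n ≠ 0) : WeakOpLim F (fun k => (h n k)⁻¹ * h m k) := by
  have key : ∀ m n : ℕ, m < n → w n ≠ 0 → WeakOpLim F (fun k => (h n k)⁻¹ * h m k) ∧
      WeakOpLim F (fun k => (h m k)⁻¹ * h n k) := fun m n hmn hw => by
    obtain ⟨C, hC⟩ := E.remainder_bounded n
    exact hD₀.weakOpLim_of_deltaLim (fun k => hD (E.gauge_mem m k))
      (fun k => hD (E.gauge_mem n k)) hC (E.deltaLim_zero hD₀ hD hmn) (E.deltaLim n) hw
  rcases hmn.lt_or_gt with hlt | hlt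
  · exact (key m n hlt (hn.resolve_left (by omega))).1
  · exact (key n m hlt (hm.resolve_left (by omega))).2

/-- Finite sums of late elementary concentrations are asymptotically small. -/
theorem exists_forall_eventually_norm_sum_le (E : IsProfileExtraction D F x h w v)
    (hD₀ : IsDislocationGroup D₀) (hD : D ⊆ (D₀ : Set (X ≃ₗᵢ[𝕜] X))) [F.NeBot] {ε : ℝ}
    (hε : 0 < ε) :
    ∃ n₀, ∀ J : Finset ℕ, (∀ n ∈ J, n₀ ≤ n) → ∀ᶠ k in F, ‖∑ n ∈ J, h n k (w n)‖ ≤ ε := by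
  have hmem : ∀ n k, h n k ∈ D₀ := fun n k => hD (E.gauge_mem n k)
  choose c hc using E.tendsto_norm
  have hanti : Antitone c := antitone_nat_of_succ_le fun n => by
    refine le_of_forall_pos_le_add fun ε hε => le_of_tendsto_of_tendsto (hc (n + 1))
      ((hc n).add_const ε) ?_
    filter_upwards [deltaLim_inv_iff.1 (E.deltaLim_zero hD₀ hD n.lt_succ_self) (-w n) ε hε] with k hk
    rw [map_neg, sub_neg_eq_add] at hk
    rwa [E.remainder_succ, sub_add_cancel, ← E.remainder_succ] at hk
  have hbdd : BddBelow (Set.range c) := ⟨0, by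
    rintro _ ⟨n, rfl⟩
    exact ge_of_tendsto' (hc n) fun k => norm_nonneg _⟩
  obtain ⟨η₀, hη₀, hUC₀⟩ := exists_pos_norm_sub_le (X := X) (c 0 + 2) hε
  obtain ⟨η, hη, hη1, hηη⟩ : ∃ η : ℝ, 0 < η ∧ η ≤ 1 ∧ η ≤ η₀ :=
    ⟨min 1 η₀, by positivity, min_le_left _ _, min_le_right _ _⟩
  have hη4 : 0 < η / 4 := by positivity
  obtain ⟨n₀, hn₀⟩ := exists_lt_of_ciInf_lt (lt_add_of_pos_right (⨅ n, c n) hη4)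
  refine ⟨n₀, fun J hJ => ?_⟩
  obtain ⟨m, hm0, hJm⟩ : ∃ m, n₀ ≤ m ∧ J ⊆ Finset.Ico n₀ m := by
    refine ⟨max n₀ (J.sup id + 1), le_max_left _ _, fun n hn => Finset.mem_Ico.2 ⟨hJ n hn, ?_⟩⟩
    exact lt_max_of_lt_right (Nat.lt_succ_of_le (Finset.le_sup (f := id) hn))
  -- Below, `b` is `v n₀` with only the concentrations in `J` removed. Its norm lies between those
  -- of `v m` and `v n₀` up to small errors.
  set L := Finset.Ico n₀ m \ J with hL
  let b : ℕ → X := fun k => v m k + ∑ i ∈ L, h i k (w i)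
  have hLm : ∀ i ∈ L, i < m := fun i hi => (Finset.mem_Ico.1 (Finset.mem_sdiff.1 hi).1).2
  have hdec : ∀ i j, j ≠ i → w i ≠ 0 → w j ≠ 0 → WeakOpLim F (fun k => (h i k)⁻¹ * h j k) :=
    fun i j hij hi hj => E.decoupled hD₀ hD hij (Or.inr hj) (Or.inr hi)
  have hbsum : ∀ k, b k + ∑ i ∈ J, h i k (w i) = v n₀ k := fun k => by
    rw [← E.remainder_add_sum hm0 k, ← Finset.sum_sdiff hJm, ← add_assoc]
  have h1 : ∀ᶠ k in F, ‖v m k‖ ≤ ‖b k‖ + η / 4 :=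
    hD₀.eventually_norm_le_norm_add_sum L hmem
      (fun i hi _ => E.deltaLim_zero hD₀ hD (hLm i hi))
      (fun i _ j _ hij hi hj => hdec i j hij hi hj) hη4
  have hb0 : ∀ i ∈ J, w i ≠ 0 → DeltaLim F (fun k => (h i k)⁻¹ (b k)) 0 := fun i hi hwi =>
    hD₀.deltaLim_inv_add_sum L (hmem i) hmem
      (E.deltaLim_zero hD₀ hD (Finset.mem_Ico.1 (hJm hi)).2) fun j hj =>
      or_iff_not_imp_left.2 fun hwj => hdec i j
        (by rintro rfl; exact (Finset.mem_sdiff.1 hj).2 hi) hwi hwj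
  have h2 : ∀ᶠ k in F, ‖b k‖ ≤ ‖v n₀ k‖ + η / 4 := by
    have := hD₀.eventually_norm_le_norm_add_sum J hmem hb0
      (fun i _ j _ hij hi hj => hdec i j hij hi hj) hη4
    simpa only [hbsum] using this
  -- Half profiles produce the midpoint of `b` and `v n₀`.
  have h3 : ∀ᶠ k in F, ‖b k‖ ≤ ‖b k + ∑ i ∈ J, h i k ((2⁻¹ : 𝕜) • w i)‖ + η / 4 := by
    have hne : ∀ i, (2⁻¹ : 𝕜) • w i ≠ 0 → w i ≠ 0 := fun i hi h0 => hi (by rw [h0, smul_zero])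
    exact hD₀.eventually_norm_le_norm_add_sum J hmem (fun i hi hwi => hb0 i hi (hne i hwi))
      (fun i _ j _ hij hi hj => hdec i j hij (hne i hi) (hne j hj)) hη4
  have hcm : c n₀ ≤ c m + η / 4 := by linarith [ciInf_le hbdd m]
  have hc0 : c n₀ ≤ c 0 := hanti n₀.zero_le
  filter_upwards [h1, h2, h3, (hc n₀).eventually (gt_mem_nhds (lt_add_of_pos_right _ hη4)),
    (hc m).eventually (lt_mem_nhds (sub_lt_self _ hη4))] with k h1 h2 h3 h4 h5
  have hmid : ‖b k + ∑ i ∈ J, h i k ((2⁻¹ : 𝕜) • w i)‖ = ‖v n₀ k + b k‖ / 2 := by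
    rw [← hbsum k]
    simp only [map_smul, ← Finset.smul_sum]
    have : b k + ∑ i ∈ J, h i k (w i) + b k =
        (2 : 𝕜) • (b k + (2⁻¹ : 𝕜) • ∑ i ∈ J, h i k (w i)) := by
      rw [smul_add, smul_smul, mul_inv_cancel₀ two_ne_zero, one_smul, two_smul]
      abel
    rw [this, norm_smul, RCLike.norm_two]
    ring
  rw [hmid] at h3
  have := hUC₀ (v n₀ k) (b k) (by linarith) (by linarith) (by linarith)
  rwa [← hbsum k, add_sub_cancel_left] at this

theorem exists_forall_norm_profile_le (E : IsProfileExtraction D F x h w v)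
    (hD₀ : IsDislocationGroup D₀) (hD : D ⊆ (D₀ : Set (X ≃ₗᵢ[𝕜] X))) [F.NeBot] {ε : ℝ}
    (hε : 0 < ε) : ∃ n₀, ∀ n ≥ n₀, ‖w n‖ ≤ ε := by
  obtain ⟨n₀, hn₀⟩ := E.exists_forall_eventually_norm_sum_le hD₀ hD hε
  refine ⟨n₀, fun n hn => ?_⟩
  obtain ⟨k, hk⟩ := (hn₀ {n} (by simpa using hn)).exists
  simpa using hk

end IsProfileExtraction

end Extraction

/-! ### Assembling the decomposition from an extraction. -/

section Existence

variable {𝕜 X : Type*} [RCLike 𝕜] [NormedAddCommGroup X] [NormedSpace 𝕜 X] [NormedSpace ℝ X]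
  [UniformConvexSpace X] [CompleteSpace X] {D : Set (X ≃ₗᵢ[𝕜] X)} {D₀ : Subgroup (X ≃ₗᵢ[𝕜] X)}
  {F : Filter ℕ} [F.NeBot] [F.IsCountablyGenerated] {x : ℕ → X} {h : ℕ → ℕ → X ≃ₗᵢ[𝕜] X}
  {w : ℕ → X} {v : ℕ → ℕ → X}

/-- A sequence that is uniformly approximated by the remainders of a profile extraction has no
nonzero profiles. -/
theorem IsProfileExtraction.gaugedDeltaTendsto_zero (E : IsProfileExtraction D F x h w v)
    (hD₀ : IsDislocationGroup D₀) (hD : D ⊆ (D₀ : Set (X ≃ₗᵢ[𝕜] X))) {φ : ℕ → ℕ}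
    (hφ : φ.Injective) (hφF : Tendsto φ atTop F) {r : ℕ → X} {C : ℝ} (hC : ∀ k, ‖r k‖ ≤ C)
    (hr : ∀ ε : ℝ, 0 < ε → ∃ n₀, ∀ n ≥ n₀, ∀ᶠ k in atTop, ‖r k - v n (φ k)‖ ≤ ε) :
    GaugedDeltaTendsto D r 0 := by
  intro g hg y ε hε
  simp only [sub_zero]
  by_contra hcon
  obtain ⟨G₀, hG₀, hn₀, hc₀, hbad⟩ := (not_eventually.1 hcon).exists_le_eventually
  have hgr : ∀ k, ‖(g k)⁻¹ (r k)‖ ≤ C := fun k => ((g k).norm_inv_apply _).trans_le (hC k)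
  obtain ⟨G₁, hG₁, hn₁, hc₁, z, hz⟩ := exists_le_deltaLim (F := G₀) hgr
  have hz0 : z ≠ 0 := by
    rintro rfl
    obtain ⟨k, h1, h2⟩ := ((hz y ε hε).and (hG₁ hbad)).exists
    rw [sub_zero] at h1
    exact h2 h1
  have hz' : 0 < ‖z‖ := norm_pos_iff.2 hz0
  obtain ⟨τ, hτ, hclose⟩ := exists_pos_norm_deltaLim_sub_le (ι := ℕ) (X := X) C (half_pos hz')
  obtain ⟨n₁, hn₁'⟩ := hr τ hτ
  -- With factor 2 from almost maximality this gives `‖z'‖ ≤ ‖z‖ / 4`, while `z'` is within `‖z‖ /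
  -- 2` of `z`.
  obtain ⟨n₂, hn₂'⟩ := E.exists_forall_norm_profile_le hD₀ hD (ε := ‖z‖ / 8) (by positivity)
  set n := max n₁ n₂
  obtain ⟨C', hC'⟩ := E.remainder_bounded (n + 1)
  obtain ⟨G₂, hG₂, hn₂, hc₂, z', hz'2⟩ := exists_le_deltaLim (F := G₁)
    (u := fun k => (g k)⁻¹ (v (n + 1) (φ k))) (C := C')
    fun k => ((g k).norm_inv_apply _).trans_le (hC' _)
  have hG₂top : G₂ ≤ atTop := hG₂.trans (hG₁.trans hG₀)
  have h1 : ‖z - z'‖ ≤ ‖z‖ / 2 := by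
    refine hclose G₂ _ _ z z' hn₂ hgr ?_ (hz.mono hG₂) hz'2
    filter_upwards [hG₂top (hn₁' (n + 1) (le_max_left n₁ n₂ |>.trans n.le_succ))] with k hk
    rwa [← map_sub, LinearIsometryEquiv.norm_inv_apply]
  have h2 : ‖z'‖ ≤ 2 * ‖w (n + 1)‖ := by
    refine E.norm_le n (map φ G₂) ((map_mono hG₂top).trans hφF) inferInstance inferInstance
      -- Almost maximality concerns the original indices, so the gauges are transported along the
      -- injection `φ`.
      (fun j => g (Function.invFun φ j)) (fun j => hg _) z' fun y' ε' hε' => ?_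
    rw [eventually_map]
    simpa only [Function.leftInverse_invFun hφ _] using hz'2 y' ε' hε'
  have h3 := hn₂' (n + 1) (le_max_right n₁ n₂ |>.trans n.le_succ)
  have h4 := norm_add_le (z - z') z'
  rw [sub_add_cancel] at h4
  linarith

theorem exists_isDeltaProfileDecomposition (hD₀ : IsDislocationGroup D₀)
    (hD : D ⊆ (D₀ : Set (X ≃ₗᵢ[𝕜] X))) (hD1 : 1 ∈ D) {x : ℕ → X} {C : ℝ} (hx : ∀ k, ‖x k‖ ≤ C) :
    ∃ (φ : ℕ → ℕ) (N : ℕ∞) (g : ℕ → ℕ → X ≃ₗᵢ[𝕜] X) (w r : ℕ → X),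
      IsDeltaProfileDecomposition D x φ N g w r := by
  obtain ⟨F, hF, hFn, hFc, h, w, v, E⟩ := exists_isProfileExtraction hD1 hx
  obtain ⟨s, hs⟩ := F.exists_seq_tendsto
  obtain ⟨ψ, hψ, hφ⟩ := strictMono_subseq_of_tendsto_atTop (hs.mono_right hF)
  set φ : ℕ → ℕ := s ∘ ψ with hφdef
  have hφF : Tendsto φ atTop F := hs.comp hψ.tendsto_atTop
  obtain ⟨K, hK⟩ := exists_max_forall_norm_sum_le (f := fun n k => h n (φ k) (w n))
    fun ε hε => by
      obtain ⟨n₀, hn₀⟩ := E.exists_forall_eventually_norm_sum_le hD₀ hD hε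
      exact ⟨n₀, fun J hJ => hφF.eventually (hn₀ J hJ)⟩
  -- Each gauge is frozen for `k < K n`: asymptotic relations are unaffected, and tails become small
  -- uniformly in `k`.
  let g : ℕ → ℕ → X ≃ₗᵢ[𝕜] X := fun n k => h n (φ (max k (K n)))
  obtain ⟨hsum, hunif⟩ := summable_and_tendstoUniformly_of_forall_norm_sum_le
    (f := fun n k => g n k (w n)) hK
  have hgh : ∀ n, ∀ᶠ k in atTop, g n k = h n (φ k) := fun n => by
    filter_upwards [eventually_ge_atTop (K n)] with k hk
    simp only [g, max_eq_left hk]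
  let r : ℕ → X := fun k => x (φ k) - ∑' n, g n k (w n)
  have hrv : ∀ ε : ℝ, 0 < ε → ∃ n₀, ∀ n ≥ n₀, ∀ᶠ k in atTop, ‖r k - v n (φ k)‖ ≤ ε := by
    intro ε hε
    obtain ⟨n₀, hn₀⟩ := eventually_atTop.1
      (tendsto_finset_range.eventually (Metric.tendstoUniformly_iff.1 hunif ε hε))
    refine ⟨n₀, fun n hn => ?_⟩
    filter_upwards [(Finset.eventually_all (Finset.range n)).2 fun m _ => hgh m] with k hk
    have h1 := (hn₀ n hn k).le
    have h2 := E.remainder_add_sum n.zero_le (φ k)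
    rw [E.remainder_zero, ← Finset.range_eq_Ico] at h2
    rw [dist_eq_norm, norm_sub_rev, Finset.sum_congr rfl fun m hm => by rw [hk m hm]] at h1
    have h3 : r k - v n (φ k) = ∑ m ∈ Finset.range n, h m (φ k) (w m) - ∑' n, g n k (w n) := by
      change x (φ k) - _ - _ = _
      rw [← h2]
      abel
    rwa [h3]
  have hrbdd : ∃ C' : ℝ, ∀ k, ‖r k‖ ≤ C' := by
    obtain ⟨t, ht⟩ := (Metric.tendstoUniformly_iff.1 hunif 1 one_pos).exists
    refine ⟨C + (∑ n ∈ t, ‖w n‖ + 1), fun k => ?_⟩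
    have h1 := (ht k).le
    rw [dist_eq_norm] at h1
    have h2 := norm_le_norm_add_norm_sub' (∑' n, g n k (w n)) (∑ n ∈ t, g n k (w n))
    have h3 : ‖∑ n ∈ t, g n k (w n)‖ ≤ ∑ n ∈ t, ‖w n‖ :=
      norm_sum_le_of_le t fun n _ => ((g n k).norm_map _).le
    have h4 := norm_sub_le (x (φ k)) (∑' n, g n k (w n))
    have h5 := hx (φ k)
    change ‖x (φ k) - ∑' n, g n k (w n)‖ ≤ _
    linarith
  obtain ⟨C', hC'⟩ := hrbdd
  -- `N` is the first index in `A`, or `⊤` if there is none. Index 0 is excluded because the profile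
  -- at the identity may vanish while others do not.
  let A : Set ℕ := {n | n ≠ 0 ∧ w n = 0}
  have hwzero : ∀ n, n ≠ 0 → w n = 0 → ∀ m, n ≤ m → w m = 0 := by
    intro n hn hwn m hnm
    induction m, hnm using Nat.le_induction with
    | base => exact hwn
    | succ m hnm ih =>
      obtain ⟨p, rfl⟩ := Nat.exists_eq_succ_of_ne_zero (show m ≠ 0 by omega)
      -- A zero profile leaves the remainder unchanged, so the next profile already competed in that
      -- selection and is at most twice zero.
      have h1 := E.norm_le p F le_rfl hFn hFc (h (p + 2)) (E.gauge_mem _) (w (p + 2)) (by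
        have h2 := E.deltaLim (p + 2)
        simp only [E.remainder_succ (p + 1), ih, map_zero, sub_zero] at h2
        exact h2)
      rw [ih, norm_zero, mul_zero, norm_le_zero_iff] at h1
      exact h1
  refine ⟨φ, ⨅ n ∈ A, (n : ℕ∞), g, w, r, ?_⟩
  have hlt : ∀ n : ℕ, (n : ℕ∞) < ⨅ n ∈ A, (n : ℕ∞) → n = 0 ∨ w n ≠ 0 := fun n hn => by
    by_contra! hcon
    exact hn.not_ge (iInf₂_le n hcon)
  exact
    { strictMono := hφ
      one_le := le_iInf₂ fun n hn => by exact_mod_cast Nat.one_le_iff_ne_zero.2 hn.1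
      profile_eq_zero := fun n hn => by
        by_contra hwn
        have : ((n + 1 : ℕ) : ℕ∞) ≤ ⨅ n ∈ A, (n : ℕ∞) := le_iInf₂ fun m hm => by
          by_contra! hcon
          exact hwn (hwzero m hm.1 hm.2 n (Nat.lt_succ_iff.1 (by exact_mod_cast hcon)))
        exact absurd (this.trans hn) (not_le.2 (Nat.cast_lt.2 n.lt_succ_self))
      gauge_mem := fun n k => E.gauge_mem _ _
      gauge_zero := fun k => E.gauge_zero _
      decoupled := fun m n hm hn hmn y => by
        refine ((E.decoupled hD₀ hD hmn (hlt m hm) (hlt n hn) y).comp hφF).congr' ?_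
        filter_upwards [hgh m, hgh n] with k h1 h2
        simp only [Function.comp_apply, h1, h2]
      summable := hsum
      uniform := hunif
      eq_add := fun k => (add_sub_cancel _ _).symm
      remainder := E.gaugedDeltaTendsto_zero hD₀ hD hφ.injective hφF hC' hrv }

end Existence

theorem mainTheorem1 {𝕜 X : Type*} [RCLike 𝕜] [NormedAddCommGroup X] [NormedSpace 𝕜 X]
    [CompleteSpace X] [UniformConvexSpace X] (hX : IsUniformlySmooth X)
    (D₀ : Subgroup (X ≃ₗᵢ[𝕜] X)) (hD₀ : IsDislocationGroup D₀)
    (D : Set (X ≃ₗᵢ[𝕜] X)) (hD : D ⊆ (D₀ : Set (X ≃ₗᵢ[𝕜] X))) (hD1 : 1 ∈ D)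
    (x : ℕ → X) (hx : Bornology.IsBounded (Set.range x)) :
    (∃ (φ : ℕ → ℕ) (N : ℕ∞) (g : ℕ → ℕ → X ≃ₗᵢ[𝕜] X) (w r : ℕ → X),
      IsDeltaProfileDecomposition D x φ N g w r) ∧
    ∀ (φ : ℕ → ℕ) (N : ℕ∞) (g : ℕ → ℕ → X ≃ₗᵢ[𝕜] X) (w r : ℕ → X),
      IsDeltaProfileDecomposition D x φ N g w r →
        (∀ n : ℕ, (n : ℕ∞) < N → DeltaTendsto (fun k => (g n k)⁻¹ (x (φ k))) (w n)) ∧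
        ((∀ k, ‖x k‖ ≤ 1) →
          (∀ n, ‖w n‖ ≤ 2) ∧
          limsup (fun k => ‖r k‖ₑ) atTop +
            ∑' n, ENNReal.ofReal (modulusOfConvexity X ‖w n‖) ≤ 1) := by
  let _ : NormedSpace ℝ X := NormedSpace.restrictScalars ℝ 𝕜 X
  obtain ⟨C, hC⟩ := hx.exists_norm_le
  refine ⟨exists_isDeltaProfileDecomposition hD₀ hD hD1 fun k => hC _ (Set.mem_range_self k),
    fun φ N g w r h => ⟨fun n hn => h.deltaLim_gauge hD₀ hD hn, fun hx1 =>
      ⟨h.norm_profile_le hD₀ hD hx1, h.limsup_enorm_add_tsum_le hD₀ hD hx1⟩⟩⟩
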